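/- For real $\alpha>1$, $b>0$ and $\nu\in\mathbb R$ let $$I_{1\alpha}=\int_0^\infty x^{\nu}\,[1+(\alpha-1)x]^{-\frac1{\alpha-1}}\,e^{-b x^{-1/2}}\,dx ,\qquad z=\frac{(\alpha-1)b^2}{4},$$ and write $(a)_r=a(a+1)\cdots(a+r-1)$, $(a)_0=1$, $\psi=\Gamma'/\Gamma$, and ${}_1F_2(a;c,d;x)=\sum_{r\ge0}\frac{(a)_r}{(c)_r(d)_r}\frac{x^r}{r!}$. **Theorem.** Let $\nu=-m-\tfrac12$ with $m\in\{0,1,2,\dots\}$, let $b>0$ and $\alpha>1$, and assume $\frac1{\alpha-1}>\nu+1=\tfrac12-m$ (the condition for the integral to converge; it is automatic for $m\ge1$ and reads $\alpha<3$ for $m=0$). Then the integral $I_{1\alpha}$ and the series below converge absolutely, and $$\begin{aligned} I_{1\alpha}=\frac{\pi^{-1/2}}{(\alpha-1)^{\frac12-m}\,\Gamma\!\left(\frac1{\alpha-1}\right)}\Bigg\{&\sqrt\pi\,\Gamma\!\left(\tfrac12-m\right)\Gamma\!\left(\tfrac1{\alpha-1}-\tfrac12+m\right)\,{}_1F_2\!\left(\tfrac1{\alpha-1}-\tfrac12+m;\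 \tfrac12,\ \tfrac12+m;\ -z\right)\\ &+\Gamma\!\left(m-\tfrac12\right)\Gamma(m)\,\Gamma\!\left(\tfrac1{\alpha-1}\right)z^{-m+\frac12}\sum_{r=0}^{m-1}\frac{(-1)^r}{r!}\,\frac{\left(\frac1{\alpha-1}\right)_r}{\left(\frac32-m\right)_r(1-m)_r}\,z^r\\ &+z^{\frac12}\sum_{r=0}^\infty z^r\left[-\ln z+C'_r\right]D'_r\Bigg\}, \end{aligned}$$ where the second of the three terms is absent (zero) if $m=0$, and $$C'_r=\psi\!\left(-\tfrac12-r\right)-\psi\!\left(\tfrac1{\alpha-1}+m+r\right)+\psi(1+r)+\psi(1+m+r),$$ $$D'_r=\frac{-2\sqrt\pi\,(-1)^{m+r}\,\Gamma\!\left(\frac1{\alpha-1}+m+r\right)}{\left(\frac32\right)_r\,r!\,(m+r)!}.$$ Moreover, for every $r=0,1,2,\dots$ the function $$s\mapsto\Gamma(s)\,\Gamma\!\left(\tfrac12+s\right)\Gamma(1+\nu+s)\,\Gamma\!\left(\tfrac1{\alpha-1}-\nu-1-s\right)z^{-s}$$ has a pole of order exactly two at $s=-\tfrac12-r$, and its residue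 there is the $r$-th term $z^{\frac12+r}\left[-\ln z+C'_r\right]D'_r$ of the logarithmic series. -/

import Mathlib

open scoped Topology Nat

noncomputable section

namespace Pathway

/-- The extended thermonuclear integral
`I_{1α} = ∫₀^∞ x^ν [1 + (α - 1) x]^{-1/(α-1)} e^{-b x^{-1/2}} dx`: its integrand. -/
def integrand (α b ν x : ℝ) : ℝ :=
  x ^ ν * (1 + (α - 1) * x) ^ (-(1 / (α - 1))) * Real.exp (-b * x ^ (-(1 / 2) : ℝ))

/-- The extended thermonuclear integral `I_{1α}`. -/
def extIntegral (α b ν : ℝ) : ℝ :=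
  ∫ x in Set.Ioi (0 : ℝ), integrand α b ν x

/-- The variable `(α - 1) b² / 4` of the series. -/
def arg (α b : ℝ) : ℝ := (α - 1) * b ^ 2 / 4

/-- The rising factorial `(a)_r = a (a + 1) ⋯ (a + r - 1)`, with `(a)_0 = 1`. -/
def poch (a : ℝ) (r : ℕ) : ℝ := (ascPochhammer ℝ r).eval a

/-- The psi function `ψ = Γ' / Γ` on the real line. -/
def psi (x : ℝ) : ℝ := logDeriv Real.Gamma x

/-- The `r`-th term of the hypergeometric series `₁F₂(a; c, d; z)`. -/
def hyp1F2Term (a c d z : ℝ) (r : ℕ) : ℝ :=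
  poch a r / (poch c r * poch d r) * z ^ r / (r ! : ℝ)

/-- The generalized hypergeometric function `₁F₂(a; c, d; z)`. -/
def hyp1F2 (a c d z : ℝ) : ℝ := ∑' r : ℕ, hyp1F2Term a c d z r

/-- The coefficient `C'_r`. -/
def coeffC (α : ℝ) (m r : ℕ) : ℝ :=
  psi (-(1 / 2) - r) - psi (1 / (α - 1) + m + r) + psi (1 + r) + psi (1 + m + r)

/-- The coefficient `D'_r`. -/
def coeffD (α : ℝ) (m r : ℕ) : ℝ :=
  -2 * √Real.pi * (-1) ^ (m + r) * Real.Gamma (1 / (α - 1) + m + r) /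
    (poch (3 / 2) r * (r ! : ℝ) * ((m + r)! : ℝ))

/-- The `r`-th term of the logarithmic series, including the common factor `z^{1/2}`, where
`z = (α - 1) b² / 4`. -/
def logTerm (α b : ℝ) (m r : ℕ) : ℝ :=
  arg α b ^ (1 / 2 : ℝ) *
    (arg α b ^ r * (-Real.log (arg α b) + coeffC α m r) * coeffD α m r)

/-- The integrand `Γ(s) Γ(1/2 + s) Γ(1 + ν + s) Γ(1/(α-1) - ν - 1 - s) z^{-s}` of the
Mellin–Barnes integral of the Meijer G-function that represents the extended integral, where
`z = (α - 1) b² / 4`. -/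
def barnesIntegrand (α b ν : ℝ) (s : ℂ) : ℂ :=
  Complex.Gamma s * Complex.Gamma (1 / 2 + s) * Complex.Gamma (1 + ν + s) *
    Complex.Gamma (1 / (α - 1) - ν - 1 - s) * (arg α b : ℂ) ^ (-s)

/-- `f` has a pole of order exactly two at `s₀`, with residue `c`. -/
def HasDoublePoleWithResidue (f : ℂ → ℂ) (s₀ c : ℂ) : Prop :=
  ∃ (A : ℂ) (g : ℂ → ℂ), A ≠ 0 ∧ AnalyticAt ℂ g s₀ ∧
    ∀ᶠ s in 𝓝[≠] s₀, f s = A / (s - s₀) ^ 2 + c / (s - s₀) + g s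

end Pathway

end

namespace Pathway

open MeasureTheory Set Filter

/-! ### The psi function -/

/-! Put β = 1/(α-1), z = `arg α b` and s = β - 1/2 + m; the convergence hypothesis says exactly that
s > 0. Expressing Γ(β)(1+(α-1)x)^(-β) as an Euler integral over w and exchanging integrals
(`Gamma_mul_extIntegral`) turns I into a weighted average, against w^(s-1) e^(-w), of the kernel
K(c) = ∫ y^(-m-1/2) e^(-y - c y^(-1/2)) dy at c = 2√(wz). The evaluation of I uses no contour
integral.

The kernel is expanded by cutting at y = 1. For y > 1 the factor e^(-c y^(-1/2)) is expanded. For y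
≤ 1 the factor e^(-y) is expanded and y = (c/t)² is substituted. Both halves give incomplete Gamma
integrals. Completing these to finite parts of Γ (`gammaFP`) creates one absolutely convergent
double series, which enters the halves with opposite signs and cancels (`kernel_expansion`). What
survives are values of `gammaFP`, which is Γ at half-odd integers and positive integers and (-1)^N
ψ(1+N)/N! at -N, together with log c from the exponents where a primitive of a power is a logarithm.

For a = -m - 1/2, even powers of c give the ₁F₂ series. The terms r < m of the second half give the
finite sum, by Legendre duplication. Odd powers pair with the terms r = j + m to give the
logarithmic series, where digamma duplication removes log 2 (`kernel_eq`). Summable bounds justify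
integrating term by term in w; the log w moments Γ'(p) = Γ(p)ψ(p) supply the remaining ψ in C'_r
(`integral_weighted_kernel`).

The pole statement is independent: at s = -1/2 - r two Gamma factors have simple poles and the
others are analytic and nonzero, so the integrand is F(s)/(s-c)² and its residue F'(c) is F(c) times
a sum of logarithmic derivatives. -/

theorem hasDerivAt_Gamma_psi {s : ℝ} (hs : ∀ n : ℕ, s ≠ -n) :
    HasDerivAt Real.Gamma (Real.Gamma s * psi s) s := by
  have h := (Real.differentiableAt_Gamma hs).hasDerivAt
  have h0 := Real.Gamma_ne_zero hs
  rwa [psi, logDeriv_apply, mul_div_cancel₀ _ h0]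

theorem complex_ne_neg_nat {s : ℝ} (hs : ∀ n : ℕ, s ≠ -n) (n : ℕ) : (s : ℂ) ≠ -n := by
  intro h
  exact hs n (by exact_mod_cast h)

theorem ne_neg_nat_of_pos {s : ℝ} (hs : 0 < s) (n : ℕ) : s ≠ -n := by
  have : (0 : ℝ) ≤ n := n.cast_nonneg
  intro h
  linarith

theorem half_sub_ne_neg_nat (k : ℤ) (n : ℕ) : (1 / 2 - k : ℝ) ≠ -n := by
  intro h
  have : (1 : ℝ) = 2 * k - 2 * n := by linarith
  have h2 : (1 : ℤ) = 2 * k - 2 * n := by exact_mod_cast this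
  omega

theorem neg_half_sub_ne_neg_nat (j n : ℕ) : (-(1 / 2) - j : ℝ) ≠ -n := by
  have := half_sub_ne_neg_nat (j + 1) n
  push_cast at this
  intro h
  exact this (by linarith)

theorem half_sub_nat_ne_neg_nat (j n : ℕ) : (1 / 2 - j : ℝ) ≠ -n := by
  simpa using half_sub_ne_neg_nat j n

/-- The complex derivative of Γ restricts to the real axis, so the recurrence of `Complex.digamma`
becomes available for `psi`. -/
theorem digamma_ofReal {s : ℝ} (hs : ∀ n : ℕ, s ≠ -n) : Complex.digamma s = psi s := by
  have h := (Complex.differentiableAt_Gamma (s : ℂ) (complex_ne_neg_nat hs)).hasDerivAt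
  have h1 : HasDerivAt (fun x : ℝ => (Real.Gamma x : ℂ)) (deriv Complex.Gamma s) s := by
    simpa [Complex.Gamma_ofReal] using h.comp_ofReal
  have h2 : HasDerivAt (fun x : ℝ => (Real.Gamma x : ℂ)) ((Real.Gamma s * psi s : ℝ) : ℂ) s :=
    (hasDerivAt_Gamma_psi hs).ofReal_comp
  have h0 : (Real.Gamma s : ℂ) ≠ 0 := by exact_mod_cast Real.Gamma_ne_zero hs
  rw [Complex.digamma_def, logDeriv_apply, h1.unique h2, Complex.Gamma_ofReal]
  push_cast
  rw [mul_div_cancel_left₀ _ h0]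

theorem psi_add_one {s : ℝ} (hs : ∀ n : ℕ, s ≠ -n) : psi (s + 1) = psi s + s⁻¹ := by
  have h1 : ∀ n : ℕ, s + 1 ≠ -n := by
    intro n h
    apply hs (n + 1)
    push_cast
    linarith
  have h := Complex.digamma_apply_add_one (s : ℂ) (complex_ne_neg_nat hs)
  rw [digamma_ofReal hs, show (s : ℂ) + 1 = ((s + 1 : ℝ) : ℂ) by push_cast; rfl,
    digamma_ofReal h1] at h
  exact_mod_cast h

theorem psi_one : psi 1 = -Real.eulerMascheroniConstant := by
  rw [psi, logDeriv_apply, Real.hasDerivAt_Gamma_one.deriv, Real.Gamma_one, div_one]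

theorem psi_one_half : psi (1 / 2) = -Real.eulerMascheroniConstant - 2 * Real.log 2 := by
  have : √Real.pi ≠ 0 := by positivity
  rw [psi, logDeriv_apply, Real.hasDerivAt_Gamma_one_half.deriv, Real.Gamma_one_half_eq]
  field_simp
  ring

theorem psi_one_add_nat_succ (n : ℕ) : psi (1 + (n + 1 : ℕ)) = psi (1 + n) + (1 + n : ℝ)⁻¹ := by
  rw [← psi_add_one (ne_neg_nat_of_pos (by positivity))]
  push_cast
  congr 1
  ring

/-- The reflection formula ψ(1-x) - ψ(x) = π cot πx at a zero of the cotangent. Here the recurrence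
alone suffices: both sides grow by 1/(3/2 + j) at each step. -/
theorem psi_neg_half_sub (j : ℕ) : psi (-(1 / 2) - j) = psi (3 / 2 + j) := by
  induction j with
  | zero =>
    have h1 := psi_add_one (s := -(1 / 2)) (fun n => by simpa using neg_half_sub_ne_neg_nat 0 n)
    have h2 := psi_add_one (s := 1 / 2) (ne_neg_nat_of_pos (by norm_num))
    norm_num at h1 h2 ⊢
    linarith
  | succ j ih =>
    have h1 := psi_add_one (s := -(1 / 2) - (j + 1 : ℕ)) (neg_half_sub_ne_neg_nat (j + 1))
    have h2 := psi_add_one (s := 3 / 2 + j) (ne_neg_nat_of_pos (by positivity))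
    rw [show -(1 / 2) - ((j + 1 : ℕ) : ℝ) + 1 = -(1 / 2) - j by push_cast; ring, ih,
      show -(1 / 2) - ((j + 1 : ℕ) : ℝ) = -(3 / 2 + j) by push_cast; ring, inv_neg] at h1
    rw [show (3 / 2 + ((j + 1 : ℕ) : ℝ)) = 3 / 2 + j + 1 by push_cast; ring, h2,
      show -(1 / 2) - ((j + 1 : ℕ) : ℝ) = -(3 / 2 + j) by push_cast; ring]
    linarith

/-- Legendre duplication for ψ at 1 + j. The term 2 log 2 later cancels the one coming from c = 2√x.
-/
theorem two_mul_psi_even (j : ℕ) :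
    2 * psi (1 + (2 * j + 1 : ℕ)) = psi (1 + j) + psi (-(1 / 2) - j) + 2 * Real.log 2 := by
  rw [psi_neg_half_sub]
  induction j with
  | zero =>
    have h1 := psi_add_one (s := 1) (ne_neg_nat_of_pos (by norm_num))
    have h2 := psi_add_one (s := 1 / 2) (ne_neg_nat_of_pos (by norm_num))
    rw [psi_one_half] at h2
    rw [psi_one] at h1
    norm_num at h1 h2 ⊢
    rw [h1, h2, psi_one]
    ring
  | succ j ih =>
    have h1 := psi_one_add_nat_succ (2 * j + 1)
    have h2 := psi_one_add_nat_succ (2 * j + 1 + 1)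
    have h3 := psi_one_add_nat_succ j
    have h4 := psi_add_one (s := 3 / 2 + j) (ne_neg_nat_of_pos (by positivity))
    rw [show 2 * (j + 1) + 1 = 2 * j + 1 + 1 + 1 by ring, h2, h1, h3,
      show (3 / 2 + ((j + 1 : ℕ) : ℝ)) = 3 / 2 + j + 1 by push_cast; ring, h4]
    have : 2 * ((1 + ((2 * j + 1 : ℕ) : ℝ))⁻¹ + (1 + ((2 * j + 1 + 1 : ℕ) : ℝ))⁻¹) =
        (1 + (j : ℝ))⁻¹ + (3 / 2 + (j : ℝ))⁻¹ := by
      push_cast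
      field_simp
      ring
    linarith

/-- Crude, but linear growth is harmless against the factorials in the series. -/
theorem abs_psi_one_add_nat_le (n : ℕ) : |psi (1 + n)| ≤ 1 + n := by
  induction n with
  | zero =>
    have h1 := Real.one_half_lt_eulerMascheroniConstant
    have h2 := Real.eulerMascheroniConstant_lt_two_thirds
    simp only [Nat.cast_zero, add_zero, psi_one, abs_neg]
    rw [abs_of_pos (by linarith)]
    linarith
  | succ n ih =>
    rw [psi_one_add_nat_succ]
    have h : |(1 + (n : ℝ))⁻¹| ≤ 1 := by
      rw [abs_of_pos (by positivity)]
      exact inv_le_one_of_one_le₀ (by simp)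
    have := abs_add_le (psi (1 + n)) (1 + (n : ℝ))⁻¹
    push_cast
    linarith

/-! ### Rising factorials and Gamma values -/

theorem poch_zero (a : ℝ) : poch a 0 = 1 := by simp [poch]

theorem poch_succ (a : ℝ) (r : ℕ) : poch a (r + 1) = poch a r * (a + r) := by
  simp [poch, ascPochhammer_succ_right]

theorem poch_pos {a : ℝ} (ha : 0 < a) (r : ℕ) : 0 < poch a r := by
  induction r with
  | zero => simp [poch_zero]
  | succ r ih => rw [poch_succ]; positivity

theorem Gamma_mul_poch {a : ℝ} (ha : 0 < a) (r : ℕ) :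
    Real.Gamma a * poch a r = Real.Gamma (a + r) := by
  induction r with
  | zero => simp [poch_zero]
  | succ r ih =>
    rw [poch_succ, ← mul_assoc, ih, show a + ((r + 1 : ℕ) : ℝ) = a + r + 1 by push_cast; ring,
      Real.Gamma_add_one (by positivity)]
    ring

/-- The downward recursion of the Gamma function, in terms of rising factorials. -/
theorem Gamma_sub_mul_poch {a : ℝ} {r : ℕ} (ha : ∀ k < r, a - (k + 1) ≠ 0) :
    Real.Gamma (a - r) * poch (1 - a) r = (-1) ^ r * Real.Gamma a := by
  induction r with
  | zero => simp [poch_zero]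
  | succ r ih =>
    have h := ih (fun k hk => ha k (by omega))
    have h1 : Real.Gamma (a - r) = (a - (r + 1)) * Real.Gamma (a - ((r + 1 : ℕ) : ℝ)) := by
      push_cast
      rw [← Real.Gamma_add_one (ha r (by omega))]
      congr 1
      ring
    rw [h1] at h
    rw [poch_succ, pow_succ]
    linear_combination (-1 : ℝ) * h

/-- Separating even and odd factors; the 4^j cancels that of c^(2j) when c = 2√x. -/
theorem four_pow_mul_poch_half (j : ℕ) :
    ((2 * j)! : ℝ) = 4 ^ j * j ! * poch (1 / 2) j := by
  induction j with
  | zero => simp [poch_zero]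
  | succ j ih =>
    rw [show 2 * (j + 1) = 2 * j + 1 + 1 by ring, Nat.factorial_succ, Nat.factorial_succ,
      Nat.factorial_succ j, poch_succ]
    push_cast
    rw [ih]
    ring

theorem four_pow_mul_poch_three_halves (j : ℕ) :
    ((2 * j + 1)! : ℝ) = 4 ^ j * j ! * poch (3 / 2) j := by
  induction j with
  | zero => simp [poch_zero]
  | succ j ih =>
    rw [show 2 * (j + 1) + 1 = 2 * j + 1 + 1 + 1 by ring, Nat.factorial_succ, Nat.factorial_succ,
      Nat.factorial_succ j, poch_succ]
    push_cast
    rw [ih]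
    ring

theorem factorial_le_poch_three_halves (j : ℕ) : (j ! : ℝ) ≤ poch (3 / 2) j := by
  induction j with
  | zero => simp [poch_zero]
  | succ j ih =>
    rw [poch_succ, Nat.factorial_succ]
    push_cast
    rw [mul_comm]
    apply mul_le_mul ih (by linarith) (by positivity) (poch_pos (by norm_num) _).le

/-! ### The finite part of Euler's integral -/

/-- The upper incomplete Gamma integral. -/
noncomputable def upperGamma (s c : ℝ) : ℝ := ∫ t in Ioi c, t ^ (s - 1) * Real.exp (-t)

theorem integrableOn_rpow_mul_exp_neg (a : ℝ) {c : ℝ} (hc : 0 < c) :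
    IntegrableOn (fun t : ℝ => t ^ a * Real.exp (-t)) (Ioi c) := by
  refine integrable_of_isBigO_exp_neg (b := 1 / 2) (by norm_num) ?_ ?_
  · intro t ht
    have : t ≠ 0 := (hc.trans_le ht).ne'
    exact ((Real.continuousAt_rpow_const _ _ (Or.inl this)).mul
      (by fun_prop)).continuousWithinAt
  · refine ((Real.Gamma_integrand_isLittleO a).isBigO).congr_left fun t => mul_comm _ _

theorem upperGamma_add_one (s : ℝ) {c : ℝ} (hc : 0 < c) :
    upperGamma (s + 1) c = s * upperGamma s c + c ^ s * Real.exp (-c) := by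
  have key := integral_Ioi_mul_deriv_eq_deriv_mul (a := c) (u := fun t : ℝ => t ^ s)
    (u' := fun t => s * t ^ (s - 1)) (v := fun t => -Real.exp (-t)) (v' := fun t => Real.exp (-t))
    (a' := -(c ^ s * Real.exp (-c))) (b' := 0)
    (fun t ht => Real.hasDerivAt_rpow_const (Or.inl (hc.trans ht).ne'))
    (fun t _ => by simpa using (hasDerivAt_neg t).exp.fun_neg)
    (integrableOn_rpow_mul_exp_neg s hc)
    (((integrableOn_rpow_mul_exp_neg (s - 1) hc).const_mul (-s)).congr
      (ae_of_all _ fun t => by simp only [Pi.mul_apply]; ring))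
    ?_ ?_
  · rw [upperGamma, upperGamma, add_sub_cancel_right, key, ← integral_const_mul]
    have : (∫ t in Ioi c, s * t ^ (s - 1) * -Real.exp (-t)) =
        -∫ t in Ioi c, s * (t ^ (s - 1) * Real.exp (-t)) := by
      rw [← integral_neg]
      congr 1
      ext t
      ring
    rw [this]
    ring
  · have hcont : ContinuousAt ((fun t : ℝ => t ^ s) * fun t => -Real.exp (-t)) c :=
      (Real.continuousAt_rpow_const _ _ (Or.inl hc.ne')).mul (by fun_prop)
    simpa using hcont.continuousWithinAt.tendsto
  · have h1 : Tendsto (fun t : ℝ => t ^ s * Real.exp (-1 * t)) atTop (𝓝 0) :=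
      tendsto_rpow_mul_exp_neg_mul_atTop_nhds_zero s 1 one_pos
    have := h1.neg
    rw [neg_zero] at this
    refine this.congr fun t => ?_
    simp

/-- The terms of the expansion of the lower incomplete Gamma integral over `(0, 1]`; the term with
`s + n = 0` is zero. -/
noncomputable def lowerTerm (s : ℝ) (n : ℕ) : ℝ := (-1) ^ n / (n ! : ℝ) * (s + n)⁻¹

/-- The finite part of `∫₀^∞ t^{s-1} e^{-t} dt`. -/
noncomputable def gammaFP (s : ℝ) : ℝ := upperGamma s 1 + ∑' n, lowerTerm s n

/-- A nonzero half-integer has absolute value at least 1/2, and 0⁻¹ = 0 covers the excluded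
denominator. Thus the series below have no small divisors. -/
theorem abs_half_int_inv_le {s : ℝ} (hs : ∃ k : ℤ, s = k / 2) : |s⁻¹| ≤ 2 := by
  obtain ⟨k, rfl⟩ := hs
  rcases eq_or_ne k 0 with rfl | hk
  · simp
  · have h1 : (1 : ℝ) ≤ |(k : ℝ)| := by exact_mod_cast Int.one_le_abs hk
    rw [inv_div, abs_div, abs_two, div_le_iff₀ (by linarith)]
    linarith

theorem half_int_add_nat {s : ℝ} (hs : ∃ k : ℤ, s = k / 2) (n : ℕ) : ∃ k : ℤ, s + n = k / 2 := by
  obtain ⟨k, rfl⟩ := hs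
  exact ⟨k + 2 * n, by push_cast; ring⟩

theorem summable_inv_factorial : Summable fun n : ℕ => ((n ! : ℝ))⁻¹ := by
  simpa using Real.summable_pow_div_factorial 1

theorem hasSum_exp (x : ℝ) : HasSum (fun n : ℕ => x ^ n / (n ! : ℝ)) (Real.exp x) := by
  rw [Real.exp_eq_exp_ℝ]
  exact NormedSpace.expSeries_div_hasSum_exp x

theorem summable_lowerTerm {s : ℝ} (hs : ∃ k : ℤ, s = k / 2) : Summable (lowerTerm s) := by
  refine Summable.of_norm_bounded (summable_inv_factorial.mul_left 2) fun n => ?_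
  have h := abs_half_int_inv_le (half_int_add_nat hs n)
  rw [lowerTerm, norm_mul, norm_div, norm_pow, norm_neg, norm_one, one_pow, Real.norm_eq_abs,
    Real.norm_eq_abs, Nat.abs_cast, one_div, mul_comm]
  gcongr

/-- Write s = (s + n) - n. The first part cancels the denominator and leaves the series of e^(-1),
except for a term with s + n = 0, which is lost; c records that loss. -/
theorem mul_tsum_lowerTerm {s c : ℝ} (hs : ∃ k : ℤ, s = k / 2)
    (hc : HasSum (fun n : ℕ => if s + n = 0 then (-1 : ℝ) ^ n / (n ! : ℝ) else 0) c) :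
    s * ∑' n, lowerTerm s n = ∑' n, lowerTerm (s + 1) n + Real.exp (-1) - c := by
  have hs1 : ∃ k : ℤ, s + 1 = k / 2 := by simpa using half_int_add_nat hs 1
  have h1 : HasSum (fun n : ℕ => (n : ℝ) * lowerTerm s n) (-∑' n, lowerTerm (s + 1) n) := by
    -- The n = 0 term vanishes, and n/n! = 1/(n-1)! shifts s to s + 1.
    rw [← hasSum_nat_add_iff' 1]
    simp only [Finset.range_one, Finset.sum_singleton, Nat.cast_zero, zero_mul, sub_zero]
    refine (summable_lowerTerm hs1).hasSum.neg.congr_fun ?_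
    intro n
    simp only [lowerTerm, Nat.factorial_succ, pow_succ]
    push_cast
    rw [show s + 1 + (n : ℝ) = s + (n + 1) by ring]
    field_simp
  have h2 := ((hasSum_exp (-1)).sub hc).sub h1
  rw [← tsum_mul_left, show ∑' n, lowerTerm (s + 1) n + Real.exp (-1) - c =
    Real.exp (-1) - c - -∑' n, lowerTerm (s + 1) n by ring, ← h2.tsum_eq]
  congr 1
  ext n
  simp only [lowerTerm]
  split_ifs with h
  · rw [h]; simp
  · field_simp
    ring

/-- The boundary terms e^(-1) of the two halves cancel, so the functional equation of Γ survives
away from its poles. -/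
theorem gammaFP_add_one {s : ℝ} (hs : ∃ k : ℤ, s = k / 2) (hs0 : ∀ n : ℕ, s ≠ -n) :
    gammaFP (s + 1) = s * gammaFP s := by
  have h := mul_tsum_lowerTerm (s := s) (c := 0) hs (by
    convert hasSum_zero using 2 with n
    rw [if_neg]
    intro h
    exact hs0 n (by linarith))
  rw [gammaFP, gammaFP, mul_add, h, upperGamma_add_one s one_pos, Real.one_rpow]
  ring

/-- At a pole the term n = N is omitted, which makes the functional equation inhomogeneous. -/
theorem gammaFP_neg_nat_add_one (N : ℕ) :
    gammaFP (-N + 1) = -N * gammaFP (-N) + (-1) ^ N / (N ! : ℝ) := by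
  have h := mul_tsum_lowerTerm (s := -N) (c := (-1) ^ N / (N ! : ℝ)) ⟨-(2 * N), by push_cast; ring⟩
    (by
      convert hasSum_ite_eq N ((-1 : ℝ) ^ N / (N ! : ℝ)) using 2 with n
      by_cases hn : n = N
      · simp [hn]
      · rw [if_neg hn, if_neg]
        intro h
        apply hn
        have : (n : ℝ) = N := by linarith
        exact_mod_cast this)
  rw [gammaFP, gammaFP, mul_add, h, upperGamma_add_one _ one_pos, Real.one_rpow]
  ring

theorem gammaFP_of_pos {s : ℝ} (hs : 0 < s) : gammaFP s = Real.Gamma s := by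
  have hint := Real.GammaIntegral_convergent hs
  rw [Real.Gamma_eq_integral hs, ← Ioc_union_Ioi_eq_Ioi (zero_le_one' ℝ),
    setIntegral_union Ioc_disjoint_Ioi_same measurableSet_Ioi
      (hint.mono_set Ioc_subset_Ioi_self) (hint.mono_set (Ioi_subset_Ioi zero_le_one)),
    gammaFP, upperGamma, add_comm]
  congr 1
  · have hpow : ∀ n : ℕ, ∫ x in Ioc (0 : ℝ) 1, x ^ (s - 1 + n) = (s + n)⁻¹ := by
      intro n
      have hn : (0 : ℝ) ≤ n := n.cast_nonneg
      rw [← intervalIntegral.integral_of_le zero_le_one, integral_rpow (Or.inl (by linarith)),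
        Real.one_rpow, Real.zero_rpow (by linarith)]
      rw [sub_zero, one_div]
      congr 1
      ring
    have hpint : ∀ n : ℕ, IntegrableOn (fun x : ℝ => x ^ (s - 1 + n)) (Ioc 0 1) := by
      intro n
      have hn : (0 : ℝ) ≤ n := n.cast_nonneg
      have := intervalIntegral.intervalIntegrable_rpow' (a := 0) (b := 1) (r := s - 1 + n)
        (by linarith)
      rwa [intervalIntegrable_iff_integrableOn_Ioc_of_le zero_le_one] at this
    have h := hasSum_integral_of_summable_integral_norm (μ := volume.restrict (Ioc (0 : ℝ) 1))
      (F := fun (n : ℕ) (x : ℝ) => (-1) ^ n / (n ! : ℝ) * x ^ (s - 1 + n))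
      (fun n => (hpint n).const_mul _) ?_
    · have h2 : HasSum (lowerTerm s)
          (∫ x in Ioc (0 : ℝ) 1, ∑' n : ℕ, (-1) ^ n / (n ! : ℝ) * x ^ (s - 1 + n)) := by
        refine h.congr_fun fun n => ?_
        rw [integral_const_mul, hpow, lowerTerm]
      rw [h2.tsum_eq]
      refine setIntegral_congr_fun measurableSet_Ioc fun x hx => ?_
      have : HasSum (fun n : ℕ => (-1) ^ n / (n ! : ℝ) * x ^ (s - 1 + n))
          (Real.exp (-x) * x ^ (s - 1)) := by
        refine ((hasSum_exp (-x)).mul_right _).congr_fun fun n => ?_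
        rw [Real.rpow_add hx.1, Real.rpow_natCast, neg_pow]
        ring
      exact this.tsum_eq
    · refine Summable.of_norm_bounded (summable_inv_factorial.mul_left s⁻¹) fun n => ?_
      have : ∫ x in Ioc (0 : ℝ) 1, ‖(-1) ^ n / (n ! : ℝ) * x ^ (s - 1 + n)‖ =
          (n ! : ℝ)⁻¹ * (s + n)⁻¹ := by
        rw [← hpow n, ← integral_const_mul]
        refine setIntegral_congr_fun measurableSet_Ioc fun x hx => ?_
        simp only [norm_mul, norm_div, norm_pow, norm_neg, norm_one, one_pow, one_div]
        rw [Real.norm_of_nonneg (Real.rpow_nonneg hx.1.le _), Real.norm_natCast]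
      rw [this, Real.norm_of_nonneg (by positivity), mul_comm]
      gcongr
      simp
  · refine setIntegral_congr_fun measurableSet_Ioi fun x _ => ?_
    exact mul_comm _ _

/-- The finite part at 0 is the limit of Γ(s) - 1/s = (Γ(1+s) - 1)/s as s → 0⁺, that is Γ'(1). -/
theorem gammaFP_zero : gammaFP 0 = psi 1 := by
  have hΓ : Tendsto (fun s : ℝ => gammaFP s - s⁻¹) (𝓝[>] 0) (𝓝 (psi 1)) := by
    have h := Real.hasDerivAt_Gamma_one.tendsto_slope_zero_right
    rw [psi_one]
    refine h.congr' ?_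
    filter_upwards [self_mem_nhdsWithin] with s hs
    have hs' : (0 : ℝ) < s := hs
    rw [gammaFP_of_pos hs', add_comm, Real.Gamma_add_one hs'.ne', Real.Gamma_one, smul_eq_mul]
    field_simp
  have hP : Tendsto (fun s : ℝ => upperGamma s 1) (𝓝[>] 0) (𝓝 (upperGamma 0 1)) := by
    refine tendsto_integral_filter_of_dominated_convergence
      (fun t => t ^ (0 : ℝ) * Real.exp (-t)) ?_ ?_ (integrableOn_rpow_mul_exp_neg 0 one_pos) ?_
    · exact Eventually.of_forall fun s =>
        (integrableOn_rpow_mul_exp_neg (s - 1) one_pos).aestronglyMeasurable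
    · have : ∀ᶠ s : ℝ in 𝓝[>] 0, s < 1 :=
        (eventually_lt_nhds one_pos).filter_mono nhdsWithin_le_nhds
      filter_upwards [this] with s hs
      filter_upwards [ae_restrict_mem measurableSet_Ioi] with t ht
      have ht' : (1 : ℝ) < t := ht
      rw [Real.norm_of_nonneg (by positivity)]
      gcongr
      · exact ht'.le
      · linarith
    · filter_upwards [ae_restrict_mem measurableSet_Ioi] with t ht
      have ht' : (0 : ℝ) < t := one_pos.trans ht
      have : Continuous fun s : ℝ => t ^ (s - 1) * Real.exp (-t) := by
        have := ht'.ne'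
        exact (Real.continuous_const_rpow this |>.comp (by fun_prop)).mul continuous_const
      exact (this.tendsto 0).mono_left nhdsWithin_le_nhds
  -- Without n = 0 the singular 1/s is gone and every denominator is at least 1.
  have hQ : Tendsto (fun s : ℝ => ∑' n : ℕ, lowerTerm s (n + 1)) (𝓝[>] 0)
      (𝓝 (∑' n : ℕ, lowerTerm 0 (n + 1))) := by
    refine tendsto_tsum_of_dominated_convergence (bound := fun n : ℕ => (((n + 1)! : ℕ) : ℝ)⁻¹)
      ((summable_nat_add_iff 1).mpr summable_inv_factorial) ?_ ?_
    · intro n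
      have : ContinuousAt (fun s : ℝ => lowerTerm s (n + 1)) 0 := by
        unfold lowerTerm
        refine continuousAt_const.mul (ContinuousAt.inv₀ (by fun_prop) ?_)
        positivity
      exact this.tendsto.mono_left nhdsWithin_le_nhds
    · filter_upwards [self_mem_nhdsWithin] with s hs n
      have hs' : (0 : ℝ) < s := hs
      have h1 : (s + (n + 1 : ℕ))⁻¹ ≤ 1 := by
        apply inv_le_one_of_one_le₀
        push_cast
        have : (0 : ℝ) ≤ n := n.cast_nonneg
        linarith
      rw [lowerTerm, norm_mul, norm_div, norm_pow, norm_neg, norm_one, one_pow,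
        Real.norm_natCast, Real.norm_of_nonneg (by positivity), one_div]
      exact mul_le_of_le_one_right (by positivity) h1
  have hsplit : ∀ s : ℝ, Summable (lowerTerm s) →
      gammaFP s - s⁻¹ = upperGamma s 1 + ∑' n : ℕ, lowerTerm s (n + 1) := by
    intro s hs
    have h := hs.sum_add_tsum_nat_add 1
    rw [gammaFP, ← h]
    simp [lowerTerm]
    ring
  -- At s = 0 the convention 0⁻¹ = 0 makes the subtracted pole vanish.
  have h0 := hsplit 0 (summable_lowerTerm ⟨0, by simp⟩)
  rw [inv_zero, sub_zero] at h0
  rw [h0]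
  refine tendsto_nhds_unique (hP.add hQ) (hΓ.congr' ?_)
  filter_upwards [self_mem_nhdsWithin] with s hs
  have hs' : (0 : ℝ) < s := hs
  refine hsplit s (Summable.of_norm_bounded (summable_inv_factorial.mul_left s⁻¹) fun n => ?_)
  rw [lowerTerm, norm_mul, norm_div, norm_pow, norm_neg, norm_one, one_pow,
    Real.norm_natCast, Real.norm_of_nonneg (by positivity), one_div, mul_comm]
  gcongr
  simp

theorem gammaFP_neg_nat (N : ℕ) : gammaFP (-N) = (-1) ^ N / (N ! : ℝ) * psi (1 + N) := by
  induction N with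
  | zero => simp [gammaFP_zero]
  | succ N ih =>
    have h := gammaFP_neg_nat_add_one (N + 1)
    have hN : (-((N + 1 : ℕ) : ℝ) + 1) = -N := by push_cast; ring
    rw [hN, ih] at h
    rw [psi_one_add_nat_succ]
    have hN0 : (-((N + 1 : ℕ) : ℝ)) ≠ 0 := by
      push_cast
      have : (0 : ℝ) ≤ N := N.cast_nonneg
      linarith
    apply mul_left_cancel₀ hN0
    rw [show -((N + 1 : ℕ) : ℝ) * gammaFP (-((N + 1 : ℕ) : ℝ)) =
      (-1) ^ N / (N ! : ℝ) * psi (1 + N) - (-1) ^ (N + 1) / ((N + 1)! : ℝ) by linarith]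
    rw [Nat.factorial_succ, pow_succ]
    push_cast
    field_simp
    ring

theorem gammaFP_half_sub_nat (N : ℕ) : gammaFP (1 / 2 - N) = Real.Gamma (1 / 2 - N) := by
  induction N with
  | zero => simpa using gammaFP_of_pos (s := 1 / 2) (by norm_num)
  | succ N ih =>
    have h0 := half_sub_nat_ne_neg_nat (N + 1)
    have h00 : (1 / 2 - ((N + 1 : ℕ) : ℝ)) ≠ 0 := by simpa using h0 0
    have h1 := gammaFP_add_one (s := 1 / 2 - (N + 1 : ℕ)) ⟨1 - 2 * (N + 1), by push_cast; ring⟩ h0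
    have h2 := Real.Gamma_add_one h00
    rw [show (1 / 2 - ((N + 1 : ℕ) : ℝ)) + 1 = 1 / 2 - N by push_cast; ring] at h1 h2
    rw [ih, h2] at h1
    exact (mul_left_cancel₀ h00 h1).symm

/-! ### The expansion of the upper incomplete Gamma integral -/

/-- The primitive of `t^{a-1}`, as a function of `a` and the endpoint `c`. -/
noncomputable def powPrimitive (a c : ℝ) : ℝ := if a = 0 then Real.log c else c ^ a / a

/-- With 0⁻¹ = 0 the same formula covers a = 0, where the integral is -log c. -/
theorem integral_rpow_sub_one (a : ℝ) {c : ℝ} (hc : 0 < c) :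
    ∫ t in c..1, t ^ (a - 1) = a⁻¹ - powPrimitive a c := by
  have h0 : (0 : ℝ) ∉ uIcc c 1 := notMem_uIcc_of_lt hc one_pos
  rw [powPrimitive]
  split_ifs with h
  · rw [h, inv_zero, zero_sub, zero_sub, ← Real.log_inv, ← one_div, ← integral_one_div h0]
    refine intervalIntegral.integral_congr fun t _ => ?_
    simp [Real.rpow_neg_one]
  · rw [integral_rpow (Or.inr ⟨fun h1 => h (by linarith), h0⟩), Real.one_rpow, sub_add_cancel]
    ring

/-- This is the finite part of the integral over (0, c]: expanding e^(-t) between c and 1 and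
subtracting from the `lowerTerm` series cancels every contribution of the endpoint 1. -/
theorem hasSum_upperGamma {s : ℝ} (hs : ∃ k : ℤ, s = k / 2) {c : ℝ} (hc : 0 < c) :
    HasSum (fun n : ℕ => (-1) ^ n / (n ! : ℝ) * powPrimitive (s + n) c)
      (gammaFP s - upperGamma s c) := by
  have hpos : ∀ t ∈ uIcc c 1, 0 < t := fun t ht =>
    (lt_inf_iff.mpr ⟨hc, one_pos⟩).trans_le ht.1
  have hcont : ∀ a : ℝ, ContinuousOn (fun t : ℝ => t ^ a) (uIcc c 1) := fun a t ht =>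
    (Real.continuousAt_rpow_const _ _ (Or.inl (hpos t ht).ne')).continuousWithinAt
  have hsum : HasSum (fun n : ℕ => ∫ t in c..1, (-1) ^ n / (n ! : ℝ) * t ^ (s + n - 1))
      (∫ t in c..1, t ^ (s - 1) * Real.exp (-t)) := by
    refine intervalIntegral.hasSum_integral_of_dominated_convergence
      -- The bound 1 + c exceeds both endpoints, whichever of c and 1 is larger.
      (fun n t => t ^ (s - 1) * ((1 + c) ^ n / (n ! : ℝ))) ?_ ?_ ?_ ?_ ?_
    · intro n
      exact ((continuousOn_const.mul (hcont _)).mono uIoc_subset_uIcc).aestronglyMeasurable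
        measurableSet_uIoc
    · intro n
      refine ae_of_all _ fun t ht => ?_
      have ht0 := hpos t (uIoc_subset_uIcc ht)
      have ht1 : t ≤ 1 + c := by
        have := (uIoc_subset_uIcc ht).2
        refine this.trans (sup_le (by linarith) (by linarith))
      rw [norm_mul, norm_div, norm_pow, norm_neg, norm_one, one_pow, Real.norm_natCast,
        Real.norm_of_nonneg (by positivity), show s + n - 1 = s - 1 + n by ring,
        Real.rpow_add ht0, Real.rpow_natCast, one_div, div_eq_inv_mul, mul_left_comm]
      gcongr
    · exact ae_of_all _ fun t _ => (Real.summable_pow_div_factorial (1 + c)).mul_left _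
    · simp_rw [tsum_mul_left]
      exact ((hcont _).mul continuousOn_const).intervalIntegrable
    · refine ae_of_all _ fun t ht => ?_
      have ht0 := hpos t (uIoc_subset_uIcc ht)
      refine ((hasSum_exp (-t)).mul_left _).congr_fun fun n => ?_
      rw [show s + n - 1 = s - 1 + n by ring, Real.rpow_add ht0, Real.rpow_natCast, neg_pow]
      ring
  have hsplit : upperGamma s c = (∫ t in c..1, t ^ (s - 1) * Real.exp (-t)) + upperGamma s 1 :=
    (intervalIntegral.integral_interval_add_Ioi (integrableOn_rpow_mul_exp_neg _ hc)
      (integrableOn_rpow_mul_exp_neg _ one_pos)).symm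
  have h := (summable_lowerTerm hs).hasSum.sub hsum
  have hval : gammaFP s - upperGamma s c =
      ∑' n, lowerTerm s n - ∫ t in c..1, t ^ (s - 1) * Real.exp (-t) := by
    rw [gammaFP, hsplit]
    ring
  rw [hval]
  refine h.congr_fun fun n => ?_
  rw [intervalIntegral.integral_const_mul, integral_rpow_sub_one _ hc, lowerTerm]
  ring

/-! ### The kernel `∫₀^∞ y^{-m-1/2} e^{-y - c y^{-1/2}} dy` -/

theorem image_sq_div_Ioi {c : ℝ} (hc : 0 < c) : (fun t : ℝ => (c / t) ^ 2) '' Ioi c = Ioo 0 1 := by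
  ext y
  constructor
  · rintro ⟨t, ht, rfl⟩
    have ht' : c < t := ht
    have ht0 := hc.trans ht'
    refine ⟨by positivity, ?_⟩
    exact pow_lt_one₀ (by positivity) ((div_lt_one ht0).mpr ht') two_ne_zero
  · rintro ⟨h0, h1⟩
    have hs : 0 < √y := Real.sqrt_pos.mpr h0
    refine ⟨c / √y, ?_, ?_⟩
    · rw [mem_Ioi, lt_div_iff₀ hs]
      have : √y < 1 := by rw [Real.sqrt_lt' one_pos]; simpa
      nlinarith
    · simp only
      rw [div_div_cancel₀ hc.ne', Real.sq_sqrt h0.le]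

theorem injOn_sq_div_Ioi {c : ℝ} (hc : 0 < c) : InjOn (fun t : ℝ => (c / t) ^ 2) (Ioi c) := by
  intro t ht u hu h
  have ht0 := hc.trans ht
  have hu0 := hc.trans hu
  have h1 : c / t = c / u :=
    (pow_left_inj₀ (by positivity) (by positivity) two_ne_zero).mp h
  field_simp at h1
  exact h1.symm

theorem hasDerivWithinAt_sq_div {c t : ℝ} (ht : t ≠ 0) (s : Set ℝ) :
    HasDerivWithinAt (fun t : ℝ => (c / t) ^ 2) (-(2 * c ^ 2 / t ^ 3)) s t := by
  have h := (((hasDerivAt_inv ht).const_mul c).pow 2).hasDerivWithinAt (s := s)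
  refine (h.congr_deriv ?_).congr (fun x _ => ?_) ?_
  · field_simp
    norm_num
    field_simp
  · simp [div_eq_mul_inv]
  · simp [div_eq_mul_inv]

/-- The substitution y = (c/t)² is chosen so that c y^(-1/2) = t, and y in (0, 1) corresponds to t >
c. -/
theorem sq_div_change_of_variable (a : ℝ) {c t : ℝ} (hc : 0 < c) (ht : t ∈ Ioi c) :
    |-(2 * c ^ 2 / t ^ 3)| • (((c / t) ^ 2) ^ a * Real.exp (-c * ((c / t) ^ 2) ^ (-(1 / 2) : ℝ))) =
      2 * c ^ (2 * a + 2) * (t ^ (-2 * a - 2 - 1) * Real.exp (-t)) := by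
  have ht0 : 0 < t := hc.trans ht
  have h1 : ((c / t) ^ 2) ^ (-(1 / 2) : ℝ) = t / c := by
    rw [← Real.rpow_natCast, ← Real.rpow_mul (by positivity)]
    norm_num
    rw [Real.rpow_neg_one, inv_div]
  have h2 : ((c / t) ^ 2) ^ a = c ^ (2 * a) * t ^ (-2 * a) := by
    rw [← Real.rpow_natCast, ← Real.rpow_mul (by positivity), Real.div_rpow hc.le ht0.le,
      neg_mul, Real.rpow_neg ht0.le]
    rfl
  rw [h1, h2, abs_neg, abs_of_pos (by positivity), smul_eq_mul, Real.rpow_add hc, Real.rpow_two,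
    show -2 * a - 2 - 1 = -2 * a - (3 : ℕ) by push_cast; ring, Real.rpow_sub ht0,
    Real.rpow_natCast, show -c * (t / c) = -t by field_simp]
  field_simp

theorem integrableOn_rpow_mul_exp_rpow (a : ℝ) {c : ℝ} (hc : 0 < c) :
    IntegrableOn (fun y : ℝ => y ^ a * Real.exp (-c * y ^ (-(1 / 2) : ℝ))) (Ioc 0 1) := by
  rw [integrableOn_Ioc_iff_integrableOn_Ioo, ← image_sq_div_Ioi hc,
    integrableOn_image_iff_integrableOn_abs_deriv_smul measurableSet_Ioi
      (fun t ht => hasDerivWithinAt_sq_div (hc.trans ht).ne' _) (injOn_sq_div_Ioi hc)]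
  have h : IntegrableOn (fun t : ℝ => 2 * c ^ (2 * a + 2) * (t ^ (-2 * a - 2 - 1) * Real.exp (-t)))
      (Ioi c) := (integrableOn_rpow_mul_exp_neg (-2 * a - 2 - 1) hc).const_mul _
  exact h.congr_fun (fun t ht => (sq_div_change_of_variable a hc ht).symm) measurableSet_Ioi

theorem integral_rpow_mul_exp_rpow (a : ℝ) {c : ℝ} (hc : 0 < c) :
    ∫ y in Ioc (0 : ℝ) 1, y ^ a * Real.exp (-c * y ^ (-(1 / 2) : ℝ)) =
      2 * c ^ (2 * a + 2) * upperGamma (-2 * a - 2) c := by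
  rw [integral_Ioc_eq_integral_Ioo, ← image_sq_div_Ioi hc,
    integral_image_eq_integral_abs_deriv_smul measurableSet_Ioi
      (fun t ht => hasDerivWithinAt_sq_div (hc.trans ht).ne' _) (injOn_sq_div_Ioi hc),
    upperGamma, ← integral_const_mul]
  exact setIntegral_congr_fun measurableSet_Ioi fun t ht => sq_div_change_of_variable a hc ht

/-- The integrand of the kernel. -/
noncomputable def kernelIntegrand (a c y : ℝ) : ℝ :=
  y ^ a * Real.exp (-y) * Real.exp (-c * y ^ (-(1 / 2) : ℝ))

/-- The kernel `∫₀^∞ y^a e^{-y - c y^{-1/2}} dy`. -/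
noncomputable def kernel (a c : ℝ) : ℝ := ∫ y in Ioi (0 : ℝ), kernelIntegrand a c y

theorem measurable_kernelIntegrand (a c : ℝ) : Measurable (kernelIntegrand a c) := by
  unfold kernelIntegrand
  fun_prop

theorem integrableOn_kernelIntegrand_Ioc (a : ℝ) {c : ℝ} (hc : 0 < c) :
    IntegrableOn (kernelIntegrand a c) (Ioc 0 1) := by
  refine (integrableOn_rpow_mul_exp_rpow a hc).mono'
    (measurable_kernelIntegrand a c).aestronglyMeasurable ?_
  filter_upwards [ae_restrict_mem measurableSet_Ioc] with y hy
  have := hy.1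
  rw [kernelIntegrand, Real.norm_of_nonneg (by positivity), mul_right_comm]
  exact mul_le_of_le_one_right (by positivity) (by simpa using hy.1.le)

theorem integrableOn_kernelIntegrand_Ioi_one (a : ℝ) {c : ℝ} (hc : 0 < c) :
    IntegrableOn (kernelIntegrand a c) (Ioi 1) := by
  refine (integrableOn_rpow_mul_exp_neg a one_pos).mono'
    (measurable_kernelIntegrand a c).aestronglyMeasurable ?_
  filter_upwards [ae_restrict_mem measurableSet_Ioi] with y hy
  have : (0 : ℝ) < y := one_pos.trans hy
  rw [kernelIntegrand, Real.norm_of_nonneg (by positivity)]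
  refine mul_le_of_le_one_right (by positivity) ?_
  rw [Real.exp_le_one_iff, neg_mul, neg_nonpos]
  positivity

/-- On y > 1 one has y^(-n/2) ≤ 1, so the norms are dominated by cⁿ/n! times a single incomplete
Gamma integral. -/
theorem hasSum_kernel_Ioi_one (a : ℝ) {c : ℝ} (hc : 0 < c) :
    HasSum (fun n : ℕ => (-c) ^ n / (n ! : ℝ) * upperGamma (a + 1 - n / 2) 1)
      (∫ y in Ioi (1 : ℝ), kernelIntegrand a c y) := by
  have hint := fun n : ℕ => integrableOn_rpow_mul_exp_neg (a - n / 2) one_pos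
  have h := hasSum_integral_of_summable_integral_norm (μ := volume.restrict (Ioi (1 : ℝ)))
    (F := fun (n : ℕ) (y : ℝ) => (-c) ^ n / (n ! : ℝ) * (y ^ (a - n / 2) * Real.exp (-y)))
    (fun n => (hint n).const_mul _) ?_
  · have hv : EqOn (fun y : ℝ => ∑' n : ℕ, (-c) ^ n / (n ! : ℝ) *
        (y ^ (a - n / 2) * Real.exp (-y))) (kernelIntegrand a c) (Ioi 1) := by
      intro y hy
      have hy0 : (0 : ℝ) < y := one_pos.trans hy
      have h2 := ((hasSum_exp (-c * y ^ (-(1 / 2) : ℝ))).mul_left (y ^ a * Real.exp (-y)))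
      rw [kernelIntegrand, ← h2.tsum_eq]
      refine tsum_congr fun n => ?_
      rw [mul_pow, ← Real.rpow_natCast (y ^ (-(1 / 2) : ℝ)), ← Real.rpow_mul hy0.le,
        show a - (n : ℝ) / 2 = a + -(1 / 2) * n by ring, Real.rpow_add hy0]
      ring
    rw [setIntegral_congr_fun measurableSet_Ioi hv] at h
    refine h.congr_fun fun n => ?_
    rw [integral_const_mul, upperGamma]
    simp only [show a + 1 - (n : ℝ) / 2 - 1 = a - n / 2 by ring]
  · refine Summable.of_norm_bounded
      ((Real.summable_pow_div_factorial c).mul_right (upperGamma (a + 1) 1)) fun n => ?_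
    rw [Real.norm_of_nonneg (integral_nonneg fun _ => norm_nonneg _), upperGamma,
      ← integral_const_mul]
    refine setIntegral_mono_on ((hint n).const_mul _).norm ?_ measurableSet_Ioi fun y hy => ?_
    · rw [add_sub_cancel_right]
      exact (integrableOn_rpow_mul_exp_neg a one_pos).const_mul (c ^ n / (n ! : ℝ))
    · have hy1 : (1 : ℝ) < y := hy
      have hy0 : (0 : ℝ) < y := one_pos.trans hy
      rw [norm_mul, norm_div, norm_pow, norm_neg, Real.norm_of_nonneg hc.le, Real.norm_natCast,
        Real.norm_of_nonneg (by positivity), add_sub_cancel_right]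
      have : a - (n : ℝ) / 2 ≤ a := by
        have : (0 : ℝ) ≤ n := n.cast_nonneg
        linarith
      gcongr
      exact hy1.le

theorem hasSum_kernel_Ioc (a : ℝ) {c : ℝ} (hc : 0 < c) :
    HasSum (fun r : ℕ => (-1) ^ r / (r ! : ℝ) *
        (2 * c ^ (2 * (a + r) + 2) * upperGamma (-2 * (a + r) - 2) c))
      (∫ y in Ioc (0 : ℝ) 1, kernelIntegrand a c y) := by
  have hint := fun r : ℕ => integrableOn_rpow_mul_exp_rpow (a + r) hc
  have h := hasSum_integral_of_summable_integral_norm (μ := volume.restrict (Ioc (0 : ℝ) 1))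
    (F := fun (r : ℕ) (y : ℝ) => (-1) ^ r / (r ! : ℝ) *
      (y ^ (a + r) * Real.exp (-c * y ^ (-(1 / 2) : ℝ))))
    (fun r => (hint r).const_mul _) ?_
  · have hv : EqOn (fun y : ℝ => ∑' r : ℕ, (-1) ^ r / (r ! : ℝ) *
        (y ^ (a + r) * Real.exp (-c * y ^ (-(1 / 2) : ℝ)))) (kernelIntegrand a c) (Ioc 0 1) := by
      intro y hy
      have h2 := ((hasSum_exp (-y)).mul_left (y ^ a * Real.exp (-c * y ^ (-(1 / 2) : ℝ))))
      rw [kernelIntegrand, mul_right_comm, ← h2.tsum_eq]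
      refine tsum_congr fun r => ?_
      rw [Real.rpow_add hy.1, Real.rpow_natCast, neg_pow]
      ring
    rw [setIntegral_congr_fun measurableSet_Ioc hv] at h
    refine h.congr_fun fun r => ?_
    rw [integral_const_mul, integral_rpow_mul_exp_rpow _ hc]
  · refine Summable.of_norm_bounded (summable_inv_factorial.mul_right
      (∫ y in Ioc (0 : ℝ) 1, y ^ a * Real.exp (-c * y ^ (-(1 / 2) : ℝ)))) fun r => ?_
    rw [Real.norm_of_nonneg (integral_nonneg fun _ => norm_nonneg _), ← integral_const_mul]
    refine setIntegral_mono_on ((hint r).const_mul _).norm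
      ((integrableOn_rpow_mul_exp_rpow a hc).const_mul _) measurableSet_Ioc fun y hy => ?_
    have hy0 := hy.1
    rw [norm_mul, norm_div, norm_pow, norm_neg, norm_one, one_pow, Real.norm_natCast,
      Real.norm_of_nonneg (by positivity), one_div, Real.rpow_add hy0, Real.rpow_natCast]
    gcongr
    exact mul_le_of_le_one_right (by positivity) (pow_le_one₀ hy0.le hy.2)

/-- The logarithmic contribution to the `r`-th term of the expansion of the kernel. -/
noncomputable def resonance (a c : ℝ) (r : ℕ) : ℝ :=
  ∑' n : ℕ, (-1) ^ n / (n ! : ℝ) * if -2 * (a + r) - 2 + n = 0 then 2 * c ^ n * Real.log c else 0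

/-- The two exponents of c add up to n, so each term is cⁿ over a linear factor, or a logarithm when
that factor vanishes. -/
theorem two_mul_rpow_mul_powPrimitive (a : ℝ) {c : ℝ} (hc : 0 < c) (r n : ℕ) :
    2 * c ^ (2 * (a + r) + 2) * powPrimitive (-2 * (a + r) - 2 + n) c =
      (if -2 * (a + r) - 2 + n = 0 then 2 * c ^ n * Real.log c else 0) -
        c ^ n * (a + 1 - n / 2 + r)⁻¹ := by
  rw [powPrimitive]
  split_ifs with h
  · rw [show 2 * (a + r) + 2 = (n : ℝ) by linarith, Real.rpow_natCast,
      show a + 1 - (n : ℝ) / 2 + r = 0 by linarith]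
    simp
  · have h1 : a + 1 - (n : ℝ) / 2 + r ≠ 0 := fun h2 => h (by linarith)
    have h2 : c ^ (2 * (a + r) + 2) * c ^ (-2 * (a + r) - 2 + n) = c ^ n := by
      rw [← Real.rpow_add hc, ← Real.rpow_natCast]
      congr 1
      ring
    rw [show -2 * (a + r) - 2 + (n : ℝ) = -2 * (a + 1 - n / 2 + r) by ring] at h2 ⊢
    rw [zero_sub, mul_div_assoc', mul_assoc, h2]
    field_simp

/-- The mixed terms of the expansion, which cancel between the two parts of the kernel. -/
noncomputable def mixedTerm (a c : ℝ) (n r : ℕ) : ℝ :=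
  (-c) ^ n / (n ! : ℝ) * lowerTerm (a + 1 - n / 2) r

theorem summable_mixedTerm {a : ℝ} (ha : ∃ k : ℤ, a = k / 2) {c : ℝ} (hc : 0 < c) :
    Summable (Function.uncurry (mixedTerm a c)) := by
  have h := (Real.summable_pow_div_factorial c).mul_of_nonneg
    (summable_inv_factorial.mul_left 2) (fun n => by positivity) (fun r => by positivity)
  refine Summable.of_norm_bounded h fun ⟨n, r⟩ => ?_
  obtain ⟨k, rfl⟩ := ha
  have hinv := abs_half_int_inv_le (s := (k : ℝ) / 2 + 1 - n / 2 + r)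
    ⟨k + 2 - n + 2 * r, by push_cast; ring⟩
  simp only [Function.uncurry_apply_pair, mixedTerm, lowerTerm]
  rw [norm_mul, norm_mul, norm_div, norm_div, norm_pow, norm_pow, norm_neg, norm_neg, norm_one,
    one_pow, Real.norm_of_nonneg hc.le, Real.norm_natCast, Real.norm_natCast, Real.norm_eq_abs,
    one_div, mul_comm (r ! : ℝ)⁻¹]
  gcongr

/-- Replacing `upperGamma` by `gammaFP` costs the double sum of `mixedTerm`, summed over r first in
one half and over n first in the other. Absolute summability makes the two orders agree, and the
signs are opposite. -/
theorem kernel_expansion {a : ℝ} (ha : ∃ k : ℤ, a = k / 2) {c : ℝ} (hc : 0 < c) :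
    Summable (fun n : ℕ => (-c) ^ n / (n ! : ℝ) * gammaFP (a + 1 - n / 2)) ∧
    Summable (fun r : ℕ => (-1) ^ r / (r ! : ℝ) *
      (2 * c ^ (2 * (a + r) + 2) * gammaFP (-2 * (a + r) - 2) - resonance a c r)) ∧
    kernel a c = ∑' n : ℕ, (-c) ^ n / (n ! : ℝ) * gammaFP (a + 1 - n / 2) +
      ∑' r : ℕ, (-1) ^ r / (r ! : ℝ) *
        (2 * c ^ (2 * (a + r) + 2) * gammaFP (-2 * (a + r) - 2) - resonance a c r) := by
  have hT := summable_mixedTerm ha hc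
  have hT1 : Summable fun n => ∑' r, mixedTerm a c n r := hT.prod
  have hT2 : Summable fun r => ∑' n, mixedTerm a c n r := hT.prod_symm.prod
  have hcomm : ∑' (r) (n), mixedTerm a c n r = ∑' (n) (r), mixedTerm a c n r := hT.tsum_comm
  have hX : HasSum (fun n : ℕ => (-c) ^ n / (n ! : ℝ) * gammaFP (a + 1 - n / 2))
      ((∫ y in Ioi (1 : ℝ), kernelIntegrand a c y) + ∑' (n) (r), mixedTerm a c n r) := by
    refine ((hasSum_kernel_Ioi_one a hc).add hT1.hasSum).congr_fun fun n => ?_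
    simp only [mixedTerm]
    rw [tsum_mul_left, gammaFP, mul_add]
  have hY : HasSum (fun r : ℕ => (-1) ^ r / (r ! : ℝ) *
      (2 * c ^ (2 * (a + r) + 2) * gammaFP (-2 * (a + r) - 2) - resonance a c r))
      ((∫ y in Ioc (0 : ℝ) 1, kernelIntegrand a c y) - ∑' (n) (r), mixedTerm a c n r) := by
    rw [← hcomm]
    refine ((hasSum_kernel_Ioc a hc).sub hT2.hasSum).congr_fun fun r => ?_
    have hr : ∃ k : ℤ, -2 * (a + r) - 2 = k / 2 := by
      obtain ⟨k, rfl⟩ := ha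
      exact ⟨-2 * k - 4 * r - 4, by push_cast; ring⟩
    have h1 := (hasSum_upperGamma hr hc).mul_left (2 * c ^ (2 * (a + r) + 2))
    -- The factor (-1)^r r! strips the r-dependent prefactor of `mixedTerm`; adding the result to
    -- `h1` leaves only the logarithms.
    have h2 : Summable fun n => (-1) ^ r * (r ! : ℝ) * mixedTerm a c n r :=
      (hT.comp_injective (Prod.mk_left_injective r)).mul_left _
    have h3 := (h1.add h2.hasSum).congr_fun (g := fun n : ℕ => (-1) ^ n / (n ! : ℝ) *
      if -2 * (a + r) - 2 + n = 0 then 2 * c ^ n * Real.log c else 0) (fun n => by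
        rw [mul_left_comm, two_mul_rpow_mul_powPrimitive a hc, mixedTerm, lowerTerm, neg_pow c]
        have : ((-1 : ℝ) ^ r) * (-1) ^ r = 1 := by rw [← mul_pow]; simp
        generalize (a + 1 - (n : ℝ) / 2 + r)⁻¹ = u
        field_simp
        linear_combination (-(c ^ n * u)) * this)
    rw [resonance, h3.tsum_eq, tsum_mul_left]
    have : ((-1 : ℝ) ^ r) * (-1) ^ r = 1 := by rw [← mul_pow]; simp
    field_simp
    linear_combination (-(r ! : ℝ) * ∑' n, mixedTerm a c n r) * this
  refine ⟨hX.summable, hY.summable, ?_⟩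
  rw [hX.tsum_eq, hY.tsum_eq, kernel, ← Ioc_union_Ioi_eq_Ioi (zero_le_one' ℝ),
    setIntegral_union Ioc_disjoint_Ioi_same measurableSet_Ioi
      (integrableOn_kernelIntegrand_Ioc a hc) (integrableOn_kernelIntegrand_Ioi_one a hc)]
  ring

/-! ### The kernel expansion at the exponent a = -m - 1/2 -/

theorem resonance_of_lt {m r : ℕ} (h : r < m) (c : ℝ) : resonance (-m - 1 / 2) c r = 0 := by
  rw [resonance]
  refine (tsum_congr fun n => ?_).trans tsum_zero
  rw [if_neg, mul_zero]
  have h1 : (r : ℝ) + 1 ≤ m := by exact_mod_cast h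
  have h2 : (0 : ℝ) ≤ n := n.cast_nonneg
  intro h
  linarith

/-- For r = j + m the exponent vanishes for n = 2j + 1 only. -/
theorem resonance_add (m j : ℕ) (c : ℝ) :
    resonance (-m - 1 / 2) c (j + m) =
      -(2 * c ^ (2 * j + 1) * Real.log c / ((2 * j + 1)! : ℝ)) := by
  rw [resonance, tsum_eq_single (2 * j + 1), if_pos, pow_succ (-1 : ℝ), pow_mul]
  · simp
    ring
  · push_cast
    ring
  · intro n hn
    rw [if_neg, mul_zero]
    intro h
    apply hn
    push_cast at h
    have : (n : ℝ) = 2 * j + 1 := by linarith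
    exact_mod_cast this

/-- The terms of the even part of the expansion of the kernel. -/
noncomputable def evenTerm (m : ℕ) (x : ℝ) (j : ℕ) : ℝ :=
  Real.Gamma (1 / 2 - m) * ((-1) ^ j / (j ! * poch (1 / 2) j * poch (1 / 2 + m) j)) * x ^ j

/-- The terms of the polar part of the expansion of the kernel. -/
noncomputable def polarTerm (m : ℕ) (x : ℝ) (r : ℕ) : ℝ :=
  (√Real.pi)⁻¹ * ((-1) ^ r / (r ! : ℝ) * (Real.Gamma (m - r) * Real.Gamma (m - r - 1 / 2))) *
    x ^ (r - m + 1 / 2 : ℝ)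

/-- The terms of the logarithmic part of the expansion of the kernel. -/
noncomputable def oddTerm (m : ℕ) (x : ℝ) (j : ℕ) : ℝ :=
  -2 * (-1) ^ (m + j) / (poch (3 / 2) j * (j ! : ℝ) * ((m + j)! : ℝ)) * x ^ (j + 1 / 2 : ℝ) *
    (psi (1 + m + j) + psi (1 + j) + psi (-(1 / 2) - j) - Real.log x)

theorem evenTerm_eq (m : ℕ) {x : ℝ} (hx : 0 < x) (j : ℕ) :
    (-(2 * √x)) ^ (2 * j) / ((2 * j)! : ℝ) * gammaFP (-m - 1 / 2 + 1 - (2 * j : ℕ) / 2) =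
      evenTerm m x j := by
  have h1 : (-(2 * √x)) ^ (2 * j) = 4 ^ j * x ^ j := by
    rw [pow_mul, neg_sq, mul_pow, Real.sq_sqrt hx.le, mul_pow]
    norm_num
  have h2 : -(m : ℝ) - 1 / 2 + 1 - (2 * j : ℕ) / 2 = 1 / 2 - (m + j : ℕ) := by push_cast; ring
  have h3 := Gamma_sub_mul_poch (a := 1 / 2 - m) (r := j) (fun k _ => by
    have := half_sub_nat_ne_neg_nat (m + (k + 1)) 0
    push_cast at this
    intro h
    apply this
    linarith)
  have h4 := poch_pos (a := 1 / 2 + m) (by positivity) j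
  have h5 := poch_pos (a := 1 / 2) (by positivity) j
  rw [show 1 - (1 / 2 - (m : ℝ)) = 1 / 2 + m by ring,
    show 1 / 2 - (m : ℝ) - j = 1 / 2 - (m + j : ℕ) by push_cast; ring] at h3
  rw [h1, h2, gammaFP_half_sub_nat, evenTerm, four_pow_mul_poch_half]
  generalize Real.Gamma (1 / 2 - (m + j : ℕ)) = g at h3 ⊢
  generalize Real.Gamma (1 / 2 - m) = g' at h3 ⊢
  generalize poch (1 / 2 + m) j = p at h3 h4 ⊢
  field_simp
  linear_combination h3

/-- The finite part is the ordinary value Γ(2(m-r) - 1), split by Legendre duplication at m - r -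
1/2. -/
theorem polarTerm_eq {m : ℕ} {x : ℝ} (hx : 0 < x) {r : ℕ} (hr : r < m) :
    (-1) ^ r / (r ! : ℝ) * (2 * (2 * √x) ^ (2 * (-m - 1 / 2 + r) + 2 : ℝ) *
      gammaFP (-2 * (-m - 1 / 2 + r) - 2) - resonance (-m - 1 / 2) (2 * √x) r) =
      polarTerm m x r := by
  have h1 : (r : ℝ) + 1 ≤ m := by exact_mod_cast hr
  have hpi : 0 < √Real.pi := Real.sqrt_pos.mpr Real.pi_pos
  have h2 := Real.Gamma_mul_Gamma_add_half (m - r - 1 / 2)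
  have h3 : (2 * √x) ^ (2 * (-m - 1 / 2 + r) + 2 : ℝ) =
      2 ^ (2 * r - 2 * m + 1 : ℝ) * x ^ (r - m + 1 / 2 : ℝ) := by
    rw [Real.mul_rpow (by norm_num) (Real.sqrt_nonneg x), Real.sqrt_eq_rpow, ← Real.rpow_mul hx.le]
    congr 2 <;> ring
  have h4 : (2 : ℝ) ^ (1 - 2 * (m - r - 1 / 2) : ℝ) = 2 * 2 ^ (2 * r - 2 * m + 1 : ℝ) := by
    rw [show (1 - 2 * (m - r - 1 / 2) : ℝ) = 1 + (2 * r - 2 * m + 1) by ring,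
      Real.rpow_add (by norm_num), Real.rpow_one]
  rw [resonance_of_lt hr, gammaFP_of_pos (by linarith), h3, polarTerm,
    mul_comm (Real.Gamma _) (Real.Gamma _)]
  rw [sub_add_cancel, h4] at h2
  rw [h2, show (-2 * (-m - 1 / 2 + r) - 2 : ℝ) = 2 * (m - r - 1 / 2) by ring]
  field_simp
  ring

/-- Both finite parts sit at poles of Γ, at -(m+j) and at -(2j+1), with the same power of x. The
second contributes 2ψ(2j+2), which `two_mul_psi_even` splits while absorbing the 2 log 2 of 2 log c.
-/
theorem oddTerm_eq (m : ℕ) {x : ℝ} (hx : 0 < x) (j : ℕ) :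
    (-(2 * √x)) ^ (2 * j + 1) / ((2 * j + 1)! : ℝ) *
        gammaFP (-m - 1 / 2 + 1 - (2 * j + 1 : ℕ) / 2) +
      (-1) ^ (j + m) / ((j + m)! : ℝ) * (2 * (2 * √x) ^ (2 * (-m - 1 / 2 + (j + m : ℕ)) + 2 : ℝ) *
        gammaFP (-2 * (-m - 1 / 2 + (j + m : ℕ)) - 2) -
          resonance (-m - 1 / 2) (2 * √x) (j + m)) =
      oddTerm m x j := by
  have h0 : (2 * √x) ^ (2 * j + 1) = 2 * 4 ^ j * x ^ (j + 1 / 2 : ℝ) := by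
    rw [Real.rpow_add hx, Real.rpow_natCast, ← Real.sqrt_eq_rpow, pow_succ, pow_mul, mul_pow,
      Real.sq_sqrt hx.le, mul_pow]
    norm_num
    ring
  have h1 : (-(2 * √x)) ^ (2 * j + 1) = -(2 * √x) ^ (2 * j + 1) := Odd.neg_pow ⟨j, rfl⟩ _
  have h2 : (-m - 1 / 2 + 1 - (2 * j + 1 : ℕ) / 2 : ℝ) = -(m + j : ℕ) := by push_cast; ring
  have h3 : (2 * (-m - 1 / 2 + (j + m : ℕ)) + 2 : ℝ) = (2 * j + 1 : ℕ) := by push_cast; ring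
  have h4 : (-2 * (-m - 1 / 2 + (j + m : ℕ)) - 2 : ℝ) = -(2 * j + 1 : ℕ) := by push_cast; ring
  have h5 := two_mul_psi_even j
  have h6 := poch_pos (a := 3 / 2) (by norm_num) j
  have h7 : Real.log (2 * √x) = Real.log 2 + Real.log x / 2 := by
    rw [Real.log_mul two_ne_zero (Real.sqrt_pos.mpr hx).ne', Real.log_sqrt hx.le]
  have h8 : (1 + m + j : ℝ) = 1 + (m + j : ℕ) := by push_cast; ring
  rw [h1, h2, h3, h4, resonance_add, gammaFP_neg_nat, gammaFP_neg_nat, Real.rpow_natCast, h0, h7,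
    oddTerm, four_pow_mul_poch_three_halves, h8, add_comm j m, pow_succ (-1 : ℝ) (2 * j),
    pow_mul (-1 : ℝ) 2 j]
  norm_num only [one_pow, one_mul]
  generalize psi (-(1 / 2) - j) = p at h5 ⊢
  generalize psi (1 + j) = p' at h5 ⊢
  field_simp
  linear_combination (-1 : ℝ) * h5

theorem kernel_eq (m : ℕ) {x : ℝ} (hx : 0 < x) :
    Summable (evenTerm m x) ∧ Summable (oddTerm m x) ∧
    kernel (-m - 1 / 2) (2 * √x) = ∑' j, evenTerm m x j +
      ∑ r ∈ Finset.range m, polarTerm m x r + ∑' j, oddTerm m x j := by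
  have hc : 0 < 2 * √x := by positivity
  obtain ⟨hX, hY, h⟩ := kernel_expansion (a := -m - 1 / 2) ⟨-2 * m - 1, by push_cast; ring⟩ hc
  have heven' := evenTerm_eq m hx
  have hodd' := oddTerm_eq m hx
  have hpolar' : ∀ r ∈ Finset.range m, _ = _ := fun r hr =>
    polarTerm_eq hx (Finset.mem_range.mp hr)
  set X : ℕ → ℝ := fun n => (-(2 * √x)) ^ n / (n ! : ℝ) * gammaFP (-m - 1 / 2 + 1 - n / 2) with hXd
  set Y : ℕ → ℝ := fun r => (-1) ^ r / (r ! : ℝ) *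
      (2 * (2 * √x) ^ (2 * (-m - 1 / 2 + r) + 2 : ℝ) * gammaFP (-2 * (-m - 1 / 2 + r) - 2) -
        resonance (-m - 1 / 2) (2 * √x) r) with hYd
  replace heven' : ∀ j, X (2 * j) = evenTerm m x j := heven'
  replace hodd' : ∀ j, X (2 * j + 1) + Y (j + m) = oddTerm m x j := hodd'
  replace hpolar' : ∀ r ∈ Finset.range m, Y r = polarTerm m x r := hpolar'
  clear_value X Y
  have hX0 : Summable fun j => X (2 * j) := hX.comp_injective (mul_right_injective₀ two_ne_zero)
  have hX1 : Summable fun j => X (2 * j + 1) :=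
    hX.comp_injective (i := fun j : ℕ => 2 * j + 1) (fun i j h => by simpa using h)
  have hYm := (summable_nat_add_iff m).mpr hY
  refine ⟨hX0.congr fun j => heven' j, (hX1.add hYm).congr fun j => hodd' j, ?_⟩
  rw [h, ← tsum_even_add_odd hX0 hX1, ← hY.sum_add_tsum_nat_add m, Finset.sum_congr rfl hpolar',
    ← tsum_congr heven', ← tsum_congr hodd', hX1.tsum_add hYm]
  ring

/-! ### Integrability, and reduction of the extended integral to the kernel -/

theorem measurable_integrand (α b ν : ℝ) : Measurable (integrand α b ν) := by
  unfold integrand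
  fun_prop

/-- The exponential controls every power at 0; at infinity the decay is x^(ν - 1/(α-1)), with
exponent below -1. -/
theorem integrableOn_integrand {α b ν : ℝ} (hα : 1 < α) (hb : 0 < b)
    (hν : ν + 1 < 1 / (α - 1)) : IntegrableOn (integrand α b ν) (Ioi 0) := by
  have hα0 : 0 < α - 1 := by linarith
  rw [← Ioc_union_Ioi_eq_Ioi (zero_le_one' ℝ)]
  refine IntegrableOn.union ?_ ?_
  · refine (integrableOn_rpow_mul_exp_rpow ν hb).mono'
      (measurable_integrand α b ν).aestronglyMeasurable ?_
    filter_upwards [ae_restrict_mem measurableSet_Ioc] with x hx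
    have hx0 := hx.1
    rw [integrand, Real.norm_of_nonneg (by positivity), mul_right_comm]
    refine mul_le_of_le_one_right (by positivity)
      (Real.rpow_le_one_of_one_le_of_nonpos ?_ ?_)
    · have : 0 < (α - 1) * x := by positivity
      linarith
    · rw [neg_nonpos]
      positivity
  · have hint : IntegrableOn (fun x : ℝ => (α - 1) ^ (-(1 / (α - 1))) * x ^ (ν - 1 / (α - 1)))
        (Ioi 1) := (integrableOn_Ioi_rpow_of_lt (by linarith) one_pos).const_mul _
    refine hint.mono' (measurable_integrand α b ν).aestronglyMeasurable ?_
    filter_upwards [ae_restrict_mem measurableSet_Ioi] with x hx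
    have hx0 : (0 : ℝ) < x := one_pos.trans hx
    rw [integrand, Real.norm_of_nonneg (by positivity)]
    have h1 : (1 + (α - 1) * x) ^ (-(1 / (α - 1))) ≤
        (α - 1) ^ (-(1 / (α - 1))) * x ^ (-(1 / (α - 1))) := by
      rw [← Real.mul_rpow hα0.le hx0.le]
      exact Real.rpow_le_rpow_of_nonpos (by positivity) (by linarith)
        (by rw [neg_nonpos]; positivity)
    have h2 : Real.exp (-b * x ^ (-(1 / 2) : ℝ)) ≤ 1 := by
      rw [Real.exp_le_one_iff, neg_mul, neg_nonpos]
      positivity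
    calc x ^ ν * (1 + (α - 1) * x) ^ (-(1 / (α - 1))) * Real.exp (-b * x ^ (-(1 / 2) : ℝ))
        ≤ x ^ ν * ((α - 1) ^ (-(1 / (α - 1))) * x ^ (-(1 / (α - 1)))) * 1 := by gcongr
      _ = (α - 1) ^ (-(1 / (α - 1))) * x ^ (ν - 1 / (α - 1)) := by
        rw [sub_eq_add_neg ν, Real.rpow_add hx0]
        ring

theorem integral_rpow_mul_exp_neg_scaled (ν : ℝ) {b c : ℝ} (hc : 0 < c) :
    ∫ x in Ioi (0 : ℝ), x ^ ν * Real.exp (-(c * x)) * Real.exp (-b * x ^ (-(1 / 2) : ℝ)) =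
      c ^ (-ν - 1) * kernel ν (b * √c) := by
  have h := integral_comp_mul_left_Ioi (kernelIntegrand ν (b * √c)) 0 hc
  rw [mul_zero, smul_eq_mul, ← kernel] at h
  have h2 : ∫ x in Ioi (0 : ℝ), kernelIntegrand ν (b * √c) (c * x) =
      c ^ ν * ∫ x in Ioi (0 : ℝ),
        x ^ ν * Real.exp (-(c * x)) * Real.exp (-b * x ^ (-(1 / 2) : ℝ)) := by
    rw [← integral_const_mul]
    refine setIntegral_congr_fun measurableSet_Ioi fun x hx => ?_
    have hx0 : (0 : ℝ) < x := hx
    have h3 : √c * (c * x) ^ (-(1 / 2) : ℝ) = x ^ (-(1 / 2) : ℝ) := by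
      rw [Real.mul_rpow hc.le hx0.le, ← mul_assoc, Real.sqrt_eq_rpow, ← Real.rpow_add hc]
      norm_num
    simp only [kernelIntegrand]
    rw [neg_mul, mul_assoc b, h3, Real.mul_rpow hc.le hx0.le, neg_mul]
    ring
  rw [h2] at h
  have h4 : c ^ (-ν) * c ^ ν = 1 := by rw [← Real.rpow_add hc]; simp
  rw [Real.rpow_sub_one hc.ne']
  linear_combination (c ^ (-ν)) * h - (∫ x in Ioi (0 : ℝ),
    x ^ ν * Real.exp (-(c * x)) * Real.exp (-b * x ^ (-(1 / 2) : ℝ))) * h4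

theorem integrableOn_rpow_mul_exp_neg_mul {a r : ℝ} (ha : 0 < a) (hr : 0 < r) :
    IntegrableOn (fun w : ℝ => w ^ (a - 1) * Real.exp (-(r * w))) (Ioi 0) := by
  -- A nonintegrable function has integral 0 by convention, so the positive value proves
  -- integrability.
  refine Integrable.of_integral_ne_zero ?_
  rw [Real.integral_rpow_mul_exp_neg_mul_Ioi ha hr]
  have := Real.Gamma_pos_of_pos ha
  positivity

theorem Gamma_mul_extIntegral {α b ν : ℝ} (hα : 1 < α) (hb : 0 < b)
    (hν : ν + 1 < 1 / (α - 1)) :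
    Real.Gamma (1 / (α - 1)) * extIntegral α b ν =
      (α - 1) ^ (-ν - 1) * ∫ w in Ioi (0 : ℝ),
        w ^ (1 / (α - 1) - ν - 1 - 1) * Real.exp (-w) * kernel ν (2 * √(w * arg α b)) := by
  have hα0 : 0 < α - 1 := by linarith
  set β := 1 / (α - 1) with hβd
  have hβ : 0 < β := by positivity
  have hΓ := Real.Gamma_pos_of_pos hβ
  let f : ℝ → ℝ → ℝ := fun x w =>
    x ^ ν * Real.exp (-b * x ^ (-(1 / 2) : ℝ)) *
      (w ^ (β - 1) * Real.exp (-((1 + (α - 1) * x) * w)))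
  have hinner : ∀ x ∈ Ioi (0 : ℝ), ∫ w in Ioi (0 : ℝ), f x w =
      Real.Gamma β * integrand α b ν x := by
    intro x hx
    have hx0 : (0 : ℝ) < x := hx
    simp only [f]
    rw [integral_const_mul, Real.integral_rpow_mul_exp_neg_mul_Ioi hβ (by positivity), integrand,
      ← hβd, one_div (1 + (α - 1) * x), Real.inv_rpow (by positivity),
      ← Real.rpow_neg (by positivity)]
    ring
  have hint : Integrable (Function.uncurry f)
      ((volume.restrict (Ioi 0)).prod (volume.restrict (Ioi 0))) := by
    have hm : Measurable (Function.uncurry f) := by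
      simp only [f, Function.uncurry_def]
      fun_prop
    rw [integrable_prod_iff hm.aestronglyMeasurable]
    constructor
    · filter_upwards [ae_restrict_mem measurableSet_Ioi] with x hx
      have hx0 : (0 : ℝ) < x := hx
      exact (integrableOn_rpow_mul_exp_neg_mul (r := 1 + (α - 1) * x) hβ
        (by positivity)).const_mul (x ^ ν * Real.exp (-b * x ^ (-(1 / 2) : ℝ)))
    -- The double integrand is nonnegative, so integrating its norm over w returns Γ(β) times the
    -- original integrand.
    · refine Integrable.congr ((integrableOn_integrand hα hb hν).const_mul (Real.Gamma β)) ?_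
      filter_upwards [ae_restrict_mem measurableSet_Ioi] with x hx
      rw [← hinner x hx]
      refine setIntegral_congr_fun measurableSet_Ioi fun w hw => ?_
      have hx0 : (0 : ℝ) < x := hx
      have hw0 : (0 : ℝ) < w := hw
      simp only [f, Function.uncurry_apply_pair]
      rw [Real.norm_of_nonneg (by positivity)]
  have hswap := integral_integral_swap hint
  rw [setIntegral_congr_fun measurableSet_Ioi hinner, integral_const_mul, ← extIntegral] at hswap
  rw [hswap, ← integral_const_mul]
  refine setIntegral_congr_fun measurableSet_Ioi fun w hw => ?_
  have hw0 : (0 : ℝ) < w := hw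
  -- The scaling y = w(α-1)x turns b into this c, which is where z = (α-1)b²/4 originates.
  have hsqrt : b * √(w * (α - 1)) = 2 * √(w * arg α b) := by
    rw [arg, show w * ((α - 1) * b ^ 2 / 4) = (b / 2) ^ 2 * (w * (α - 1)) by ring,
      Real.sqrt_mul (sq_nonneg (b / 2)), Real.sqrt_sq (by positivity)]
    ring
  have h1 := integral_rpow_mul_exp_neg_scaled ν (b := b) (c := w * (α - 1)) (by positivity)
  rw [hsqrt, Real.mul_rpow hw0.le hα0.le] at h1
  have h2 : ∫ x in Ioi (0 : ℝ), f x w = w ^ (β - 1) * Real.exp (-w) * ∫ x in Ioi (0 : ℝ),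
      x ^ ν * Real.exp (-(w * (α - 1) * x)) * Real.exp (-b * x ^ (-(1 / 2) : ℝ)) := by
    rw [← integral_const_mul]
    refine integral_congr_ae (ae_of_all _ fun x => ?_)
    simp only [f]
    rw [show -((1 + (α - 1) * x) * w) = -w + -(w * (α - 1) * x) by ring, Real.exp_add]
    ring
  rw [h2, h1, show β - ν - 1 - 1 = β - 1 + (-ν - 1) by ring, Real.rpow_add hw0]
  ring

/-! ### Summability of the majorants -/

theorem hyp1F2Term_ratio {a c d x : ℝ} (hc : 0 < c) (hd : 0 < d) (r : ℕ) :
    hyp1F2Term a c d x (r + 1) =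
      hyp1F2Term a c d x r * ((a + r) / (c + r) * (x / ((d + r) * (r + 1)))) := by
  have h1 := poch_pos hc r
  have h2 := poch_pos hd r
  have h3 : 0 < c + r := by positivity
  have h4 : 0 < d + r := by positivity
  simp only [hyp1F2Term, poch_succ, Nat.factorial_succ, pow_succ]
  push_cast
  field_simp

theorem summable_hyp1F2Term {a c d x : ℝ} (ha : 0 < a) (hc : 0 < c) (hd : 0 < d) (hx : x ≠ 0) :
    Summable (hyp1F2Term a c d x) := by
  have hne : ∀ r, hyp1F2Term a c d x r ≠ 0 := by
    intro r
    have h1 := poch_pos hc r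
    have h2 := poch_pos hd r
    have h3 := poch_pos ha r
    rw [hyp1F2Term]
    positivity
  refine summable_of_ratio_test_tendsto_lt_one zero_lt_one (Eventually.of_forall hne) ?_
  have h1 : Tendsto (fun r : ℕ => (a + 1 * r) / (c + 1 * r)) atTop (𝓝 (1 / 1)) :=
    tendsto_add_mul_div_add_mul_atTop_nhds a c 1 one_ne_zero
  have h2 : Tendsto (fun r : ℕ => x / ((d + r) * (r + 1))) atTop (𝓝 0) := by
    refine Tendsto.div_atTop tendsto_const_nhds ?_
    refine Tendsto.atTop_mul_atTop₀ ?_ ?_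
    · exact tendsto_atTop_add_const_left _ _ tendsto_natCast_atTop_atTop
    · exact tendsto_atTop_add_const_right _ _ tendsto_natCast_atTop_atTop
  have h3 := (h1.mul h2).norm
  simp only [one_mul, div_one, norm_zero] at h3
  refine h3.congr fun r => ?_
  rw [hyp1F2Term_ratio hc hd, norm_mul (hyp1F2Term a c d x r), mul_div_cancel_left₀ _ (norm_ne_zero_iff.mpr (hne r))]

/-- Since j + 1 ≤ 2^j and (1)_j = j!, the terms are bounded by Γ(p) times those of ₁F₂(p; 1, 1; 2z).
-/
theorem summable_Gamma_majorant {p z : ℝ} (hp : 0 < p) (hz : 0 < z) :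
    Summable fun j : ℕ => ((j : ℝ) + 1) * z ^ j * Real.Gamma (p + j) / (j ! : ℝ) ^ 3 := by
  have h := (summable_hyp1F2Term (a := p) (c := 1) (d := 1) (x := 2 * z) hp one_pos one_pos
    (by positivity)).mul_left (Real.Gamma p)
  have hone : ∀ j : ℕ, poch 1 j = j ! := by
    intro j
    have := Gamma_mul_poch one_pos j
    rwa [Real.Gamma_one, one_mul, add_comm, Real.Gamma_nat_eq_factorial] at this
  refine Summable.of_nonneg_of_le (fun j => ?_) (fun j => ?_) h
  · have := Real.Gamma_pos_of_pos (s := p + j) (by positivity)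
    positivity
  · have h1 : (j : ℝ) + 1 ≤ 2 ^ j := by exact_mod_cast Nat.lt_two_pow_self
    have h2 := Real.Gamma_pos_of_pos (s := p + j) (by positivity)
    have h3 : Real.Gamma p * hyp1F2Term p 1 1 (2 * z) j =
        2 ^ j * z ^ j * Real.Gamma (p + j) / (j ! : ℝ) ^ 3 := by
      rw [hyp1F2Term, hone, ← Gamma_mul_poch hp, mul_pow]
      field_simp
    rw [h3]
    gcongr

/-! ### Logarithmic moments -/

/-- Apply log x ≤ x^ε/ε with ε = 1/2 to w and to 1/w. A logarithm thus costs a shift of the Gamma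
argument by ±1/2. -/
theorem abs_log_le {w : ℝ} (hw : 0 < w) :
    |Real.log w| ≤ 2 * (w ^ (1 / 2 : ℝ) + w ^ (-(1 / 2) : ℝ)) := by
  have h1 := Real.log_le_rpow_div hw.le (ε := 1 / 2) (by norm_num)
  have h2 := Real.log_le_rpow_div (inv_pos.mpr hw).le (ε := 1 / 2) (by norm_num)
  rw [Real.log_inv, Real.inv_rpow hw.le, ← Real.rpow_neg hw.le] at h2
  have h3 : 0 < w ^ (1 / 2 : ℝ) := by positivity
  have h4 : 0 < w ^ (-(1 / 2) : ℝ) := by positivity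
  rw [abs_le]
  constructor <;> linarith

theorem integrableOn_rpow_mul_exp {p : ℝ} (hp : 0 < p) :
    IntegrableOn (fun w : ℝ => w ^ (p - 1) * Real.exp (-w)) (Ioi 0) := by
  simpa using integrableOn_rpow_mul_exp_neg_mul hp one_pos

theorem integral_rpow_mul_exp {p : ℝ} (hp : 0 < p) :
    ∫ w in Ioi (0 : ℝ), w ^ (p - 1) * Real.exp (-w) = Real.Gamma p := by
  simpa using Real.integral_rpow_mul_exp_neg_mul_Ioi hp one_pos

theorem log_moment_bound {p w : ℝ} (hw : 0 < w) :
    w ^ (p - 1) * Real.exp (-w) * |Real.log w| ≤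
      2 * (w ^ (p + 1 / 2 - 1) * Real.exp (-w)) + 2 * (w ^ (p - 1 / 2 - 1) * Real.exp (-w)) := by
  have h := mul_le_mul_of_nonneg_left (abs_log_le hw)
    (show 0 ≤ w ^ (p - 1) * Real.exp (-w) by positivity)
  refine h.trans_eq ?_
  rw [show p + 1 / 2 - 1 = p - 1 + 1 / 2 by ring, show p - 1 / 2 - 1 = p - 1 + -(1 / 2) by ring,
    Real.rpow_add hw, Real.rpow_add hw]
  ring

theorem integrableOn_log_majorant {p : ℝ} (hp : 1 / 2 < p) :
    IntegrableOn (fun w : ℝ => 2 * (w ^ (p + 1 / 2 - 1) * Real.exp (-w)) +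
      2 * (w ^ (p - 1 / 2 - 1) * Real.exp (-w))) (Ioi 0) :=
  ((integrableOn_rpow_mul_exp (by linarith)).const_mul 2).add
    ((integrableOn_rpow_mul_exp (by linarith)).const_mul 2)

theorem integrableOn_abs_log_moment {p : ℝ} (hp : 1 / 2 < p) :
    IntegrableOn (fun w : ℝ => w ^ (p - 1) * Real.exp (-w) * |Real.log w|) (Ioi 0) := by
  refine (integrableOn_log_majorant hp).mono' (Measurable.aestronglyMeasurable (by fun_prop)) ?_
  filter_upwards [ae_restrict_mem measurableSet_Ioi] with w hw
  have hw0 : (0 : ℝ) < w := hw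
  rw [Real.norm_of_nonneg (by positivity)]
  exact log_moment_bound hw0

theorem integral_abs_log_moment_le {p : ℝ} (hp : 1 / 2 < p) :
    ∫ w in Ioi (0 : ℝ), w ^ (p - 1) * Real.exp (-w) * |Real.log w| ≤
      2 * Real.Gamma (p + 1 / 2) + 2 * Real.Gamma (p - 1 / 2) := by
  rw [← integral_rpow_mul_exp (p := p + 1 / 2) (by linarith),
    ← integral_rpow_mul_exp (p := p - 1 / 2) (by linarith), ← integral_const_mul,
    ← integral_const_mul, ← integral_add]
  · exact setIntegral_mono_on (integrableOn_abs_log_moment hp) (integrableOn_log_majorant hp)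
      measurableSet_Ioi fun w hw => log_moment_bound hw
  · exact (integrableOn_rpow_mul_exp (by linarith)).const_mul 2
  · exact (integrableOn_rpow_mul_exp (by linarith)).const_mul 2

theorem integrableOn_log_moment {p : ℝ} (hp : 1 / 2 < p) :
    IntegrableOn (fun w : ℝ => w ^ (p - 1) * Real.exp (-w) * Real.log w) (Ioi 0) := by
  refine (integrableOn_abs_log_moment hp).mono' (Measurable.aestronglyMeasurable (by fun_prop)) ?_
  filter_upwards [ae_restrict_mem measurableSet_Ioi] with w hw
  have hw0 : (0 : ℝ) < w := hw
  rw [norm_mul, Real.norm_of_nonneg (by positivity), Real.norm_eq_abs]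

/-- Differentiation of Euler's integral in p, taken from the complex case. -/
theorem integral_log_moment {p : ℝ} (hp : 0 < p) :
    ∫ w in Ioi (0 : ℝ), w ^ (p - 1) * Real.exp (-w) * Real.log w = Real.Gamma p * psi p := by
  have h1 := Complex.hasDerivAt_GammaIntegral (s := p) (by simpa)
  have h2 : HasDerivAt Complex.Gamma
      (∫ t : ℝ in Ioi 0, (t : ℂ) ^ ((p : ℂ) - 1) * (Real.log t * Real.exp (-t))) p := by
    refine h1.congr_of_eventuallyEq ?_
    have : ∀ᶠ s : ℂ in 𝓝 (p : ℂ), 0 < s.re :=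
      Complex.continuous_re.continuousAt.eventually (lt_mem_nhds (by simpa))
    filter_upwards [this] with s hs
    exact Complex.Gamma_eq_integral hs
  have h3 : HasDerivAt (fun x : ℝ => (Real.Gamma x : ℂ))
      (∫ t : ℝ in Ioi 0, (t : ℂ) ^ ((p : ℂ) - 1) * (Real.log t * Real.exp (-t))) p := by
    simpa [Complex.Gamma_ofReal] using h2.comp_ofReal
  have h4 := h3.unique (hasDerivAt_Gamma_psi (ne_neg_nat_of_pos hp)).ofReal_comp
  have h5 : ∫ t : ℝ in Ioi 0, (t : ℂ) ^ ((p : ℂ) - 1) * (Real.log t * Real.exp (-t)) =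
      ((∫ w in Ioi (0 : ℝ), w ^ (p - 1) * Real.exp (-w) * Real.log w : ℝ) : ℂ) := by
    refine Eq.trans ?_ integral_complex_ofReal
    refine setIntegral_congr_fun measurableSet_Ioi fun t ht => ?_
    have ht0 : (0 : ℝ) < t := ht
    rw [show (p : ℂ) - 1 = ((p - 1 : ℝ) : ℂ) by push_cast; rfl, ← Complex.ofReal_cpow ht0.le]
    push_cast
    ring
  rw [h5] at h4
  exact_mod_cast h4

/-! ### Termwise integration of the expansion of the kernel -/

theorem weighted_rpow {s q z w : ℝ} (hz : 0 < z) (hw : 0 < w) :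
    w ^ (s - 1) * Real.exp (-w) * (w * z) ^ q =
      z ^ q * (w ^ (s + q - 1) * Real.exp (-w)) := by
  rw [Real.mul_rpow hw.le hz.le, show s + q - 1 = s - 1 + q by ring, Real.rpow_add hw]
  ring

theorem integrableOn_weighted_rpow {s q z : ℝ} (hz : 0 < z) (hsq : 0 < s + q) :
    IntegrableOn (fun w : ℝ => w ^ (s - 1) * Real.exp (-w) * (w * z) ^ q) (Ioi 0) := by
  have h : IntegrableOn (fun w : ℝ => z ^ q * (w ^ (s + q - 1) * Real.exp (-w))) (Ioi 0) :=
    (integrableOn_rpow_mul_exp hsq).const_mul _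
  exact h.congr_fun (fun w hw => (weighted_rpow hz hw).symm) measurableSet_Ioi

theorem integral_weighted_rpow {s q z : ℝ} (hz : 0 < z) (hsq : 0 < s + q) :
    ∫ w in Ioi (0 : ℝ), w ^ (s - 1) * Real.exp (-w) * (w * z) ^ q =
      z ^ q * Real.Gamma (s + q) := by
  rw [setIntegral_congr_fun measurableSet_Ioi fun w hw => weighted_rpow hz hw,
    integral_const_mul, integral_rpow_mul_exp hsq]

theorem integrableOn_weighted_evenTerm {s z : ℝ} (hs : 0 < s) (hz : 0 < z) (m j : ℕ) :
    IntegrableOn (fun w : ℝ => w ^ (s - 1) * Real.exp (-w) * evenTerm m (w * z) j) (Ioi 0) := by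
  have h := (integrableOn_weighted_rpow (q := j) hz (s := s) (by positivity)).const_mul
    (Real.Gamma (1 / 2 - m) * ((-1) ^ j / (j ! * poch (1 / 2) j * poch (1 / 2 + m) j)))
  refine Integrable.congr h (ae_of_all _ fun w => ?_)
  simp only [evenTerm, Real.rpow_natCast]
  ring

theorem integral_weighted_evenTerm {s z : ℝ} (hs : 0 < s) (hz : 0 < z) (m j : ℕ) :
    ∫ w in Ioi (0 : ℝ), w ^ (s - 1) * Real.exp (-w) * evenTerm m (w * z) j =
      Real.Gamma (1 / 2 - m) * Real.Gamma s * hyp1F2Term s (1 / 2) (1 / 2 + m) (-z) j := by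
  have h := integral_weighted_rpow (q := j) hz (s := s) (by positivity)
  have h2 : ∀ w : ℝ, w ^ (s - 1) * Real.exp (-w) * evenTerm m (w * z) j =
      Real.Gamma (1 / 2 - m) * ((-1) ^ j / (j ! * poch (1 / 2) j * poch (1 / 2 + m) j)) *
        (w ^ (s - 1) * Real.exp (-w) * (w * z) ^ (j : ℝ)) := by
    intro w
    simp only [evenTerm, Real.rpow_natCast]
    ring
  simp only [h2]
  have h4 := poch_pos (a := 1 / 2 + m) (by positivity) j
  have h5 := poch_pos (a := 1 / 2) (by positivity) j
  rw [integral_const_mul, h, hyp1F2Term, ← Gamma_mul_poch hs, Real.rpow_natCast, neg_pow z]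
  generalize poch (1 / 2 + m) j = p at h4 ⊢
  field_simp

/-- Each term has constant sign in w, so its L¹ norm is the absolute value of its integral, and
summability is that of the ₁F₂ series. -/
theorem integral_norm_weighted_evenTerm {s z : ℝ} (hs : 0 < s) (hz : 0 < z) (m j : ℕ) :
    ∫ w in Ioi (0 : ℝ), ‖w ^ (s - 1) * Real.exp (-w) * evenTerm m (w * z) j‖ =
      ‖Real.Gamma (1 / 2 - m) * Real.Gamma s * hyp1F2Term s (1 / 2) (1 / 2 + m) (-z) j‖ := by
  rw [← integral_weighted_evenTerm hs hz]
  have h2 : ∀ w ∈ Ioi (0 : ℝ), w ^ (s - 1) * Real.exp (-w) * evenTerm m (w * z) j =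
      Real.Gamma (1 / 2 - m) * ((-1) ^ j / (j ! * poch (1 / 2) j * poch (1 / 2 + m) j)) *
        (w ^ (s - 1) * Real.exp (-w) * (w * z) ^ j) := by
    intro w _
    simp only [evenTerm]
    ring
  have h3 : ∀ w ∈ Ioi (0 : ℝ), ‖w ^ (s - 1) * Real.exp (-w) * evenTerm m (w * z) j‖ =
      ‖Real.Gamma (1 / 2 - m) * ((-1) ^ j / (j ! * poch (1 / 2) j * poch (1 / 2 + m) j))‖ *
        (w ^ (s - 1) * Real.exp (-w) * (w * z) ^ j) := by
    intro w hw
    have hw0 : (0 : ℝ) < w := hw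
    rw [h2 w hw, norm_mul, Real.norm_of_nonneg
      (show 0 ≤ w ^ (s - 1) * Real.exp (-w) * (w * z) ^ j by positivity)]
  have h4 : 0 ≤ ∫ w in Ioi (0 : ℝ), w ^ (s - 1) * Real.exp (-w) * (w * z) ^ j :=
    setIntegral_nonneg measurableSet_Ioi fun w hw => by
      have hw0 : (0 : ℝ) < w := hw
      positivity
  rw [setIntegral_congr_fun measurableSet_Ioi h2, setIntegral_congr_fun measurableSet_Ioi h3,
    integral_const_mul, integral_const_mul, norm_mul _ (∫ w in Ioi (0 : ℝ), _),
    Real.norm_of_nonneg h4]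

theorem weighted_oddTerm (m : ℕ) {s z w : ℝ} (hz : 0 < z) (hw : 0 < w) (j : ℕ) :
    w ^ (s - 1) * Real.exp (-w) * oddTerm m (w * z) j =
      -2 * (-1) ^ (m + j) / (poch (3 / 2) j * (j ! : ℝ) * ((m + j)! : ℝ)) * z ^ (j + 1 / 2 : ℝ) *
        ((psi (1 + m + j) + psi (1 + j) + psi (-(1 / 2) - j) - Real.log z) *
          (w ^ (s + (j + 1 / 2) - 1) * Real.exp (-w)) -
            w ^ (s + (j + 1 / 2) - 1) * Real.exp (-w) * Real.log w) := by
  have h := weighted_rpow (s := s) (q := j + 1 / 2) hz hw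
  rw [oddTerm, Real.log_mul hw.ne' hz.ne']
  linear_combination (-2 * (-1) ^ (m + j) / (poch (3 / 2) j * (j ! : ℝ) * ((m + j)! : ℝ)) *
    (psi (1 + m + j) + psi (1 + j) + psi (-(1 / 2) - j) - (Real.log w + Real.log z))) * h

theorem integrableOn_weighted_oddTerm {s z : ℝ} (hs : 0 < s) (hz : 0 < z) (m j : ℕ) :
    IntegrableOn (fun w : ℝ => w ^ (s - 1) * Real.exp (-w) * oddTerm m (w * z) j) (Ioi 0) := by
  have hj : (0 : ℝ) ≤ j := j.cast_nonneg
  have h1 := (integrableOn_rpow_mul_exp (p := s + (j + 1 / 2)) (by linarith)).const_mul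
    (psi (1 + m + j) + psi (1 + j) + psi (-(1 / 2) - j) - Real.log z)
  have h2 := integrableOn_log_moment (p := s + (j + 1 / 2)) (by linarith)
  refine IntegrableOn.congr_fun ((h1.sub h2).const_mul (-2 * (-1) ^ (m + j) /
    (poch (3 / 2) j * (j ! : ℝ) * ((m + j)! : ℝ)) * z ^ (j + 1 / 2 : ℝ))) (fun w hw => ?_)
    measurableSet_Ioi
  exact (weighted_oddTerm m hz hw j).symm

theorem integral_weighted_oddTerm {s z : ℝ} (hs : 0 < s) (hz : 0 < z) (m j : ℕ) :
    ∫ w in Ioi (0 : ℝ), w ^ (s - 1) * Real.exp (-w) * oddTerm m (w * z) j =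
      -2 * (-1) ^ (m + j) / (poch (3 / 2) j * (j ! : ℝ) * ((m + j)! : ℝ)) * z ^ (j + 1 / 2 : ℝ) *
        Real.Gamma (s + (j + 1 / 2)) * (-Real.log z + (psi (-(1 / 2) - j) -
          psi (s + (j + 1 / 2)) + psi (1 + j) + psi (1 + m + j))) := by
  have hj : (0 : ℝ) ≤ j := j.cast_nonneg
  have h1 := (integrableOn_rpow_mul_exp (p := s + (j + 1 / 2)) (by linarith)).const_mul
    (psi (1 + m + j) + psi (1 + j) + psi (-(1 / 2) - j) - Real.log z)
  have h2 := integrableOn_log_moment (p := s + (j + 1 / 2)) (by linarith)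
  rw [setIntegral_congr_fun measurableSet_Ioi fun w hw => weighted_oddTerm m hz hw j,
    integral_const_mul, integral_sub h1 h2, integral_const_mul,
    integral_rpow_mul_exp (by linarith), integral_log_moment (by linarith)]
  ring

/-- A summable majorant of the logarithmic part. -/
noncomputable def oddMajorant (m : ℕ) (s z : ℝ) (j : ℕ) : ℝ :=
  2 * z ^ (1 / 2 : ℝ) * ((m + 7 + |Real.log z|) *
      ((j + 1) * z ^ j * Real.Gamma (s + 1 / 2 + j) / (j ! : ℝ) ^ 3) +
    2 * ((j + 1) * z ^ j * Real.Gamma (s + 1 + j) / (j ! : ℝ) ^ 3) +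
    2 * ((j + 1) * z ^ j * Real.Gamma (s + j) / (j ! : ℝ) ^ 3))

theorem summable_oddMajorant (m : ℕ) {s z : ℝ} (hs : 0 < s) (hz : 0 < z) :
    Summable (oddMajorant m s z) :=
  ((((summable_Gamma_majorant (p := s + 1 / 2) (by linarith) hz).mul_left _).add
    ((summable_Gamma_majorant (p := s + 1) (by linarith) hz).mul_left _)).add
    ((summable_Gamma_majorant hs hz).mul_left _)).mul_left _

theorem abs_odd_coefficient_le (m j : ℕ) :
    |-2 * (-1) ^ (m + j) / (poch (3 / 2) j * (j ! : ℝ) * ((m + j)! : ℝ))| ≤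
      2 / (j ! : ℝ) ^ 3 := by
  have h1 := factorial_le_poch_three_halves j
  have h2 : (j ! : ℝ) ≤ ((m + j)! : ℝ) := by
    exact_mod_cast Nat.factorial_le (Nat.le_add_left j m)
  have h3 := poch_pos (a := 3 / 2) (by norm_num) j
  rw [abs_div, abs_mul, abs_pow, abs_neg, abs_neg, abs_one, one_pow, mul_one, abs_two,
    abs_of_pos (show 0 < poch (3 / 2) j * (j ! : ℝ) * ((m + j)! : ℝ) by positivity),
    show (j ! : ℝ) ^ 3 = (j ! : ℝ) * (j ! : ℝ) * (j ! : ℝ) by ring]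
  gcongr

/-- Duplication rewrites the sum as ψ(1+m+j) + 2ψ(2j+2) - 2 log 2 - l; the constant 7 covers 1 + 4 +
2 log 2, and the factor j + 1 covers the growth 5j. -/
theorem abs_odd_constant_le (m j : ℕ) (l : ℝ) :
    |psi (1 + m + j) + psi (1 + j) + psi (-(1 / 2) - j) - l| ≤ (m + 7 + |l|) * (j + 1) := by
  have h1 := abs_psi_one_add_nat_le (m + j)
  have h2 := abs_psi_one_add_nat_le (2 * j + 1)
  have h3 := two_mul_psi_even j
  have h4 := Real.log_two_lt_d9
  have h5 := Real.log_two_gt_d9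
  push_cast at h1 h2 h3
  rw [← add_assoc] at h1
  rw [show psi (1 + m + j) + psi (1 + j) + psi (-(1 / 2) - j) - l =
    psi (1 + m + j) + 2 * psi (1 + (2 * j + 1)) - 2 * Real.log 2 - l by linarith]
  have h6 : (0 : ℝ) ≤ m * j := by positivity
  have h7 : 0 ≤ |l| * j := by positivity
  have h8 : (0 : ℝ) ≤ j := j.cast_nonneg
  rw [abs_le] at h1 h2 ⊢
  have h9 := neg_abs_le l
  have h10 := le_abs_self l
  constructor <;> nlinarith

theorem integral_norm_weighted_oddTerm_le {s z : ℝ} (hs : 0 < s) (hz : 0 < z) (m j : ℕ) :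
    ∫ w in Ioi (0 : ℝ), ‖w ^ (s - 1) * Real.exp (-w) * oddTerm m (w * z) j‖ ≤
      oddMajorant m s z j := by
  have hj : (0 : ℝ) ≤ j := j.cast_nonneg
  set A := psi (1 + m + j) + psi (1 + j) + psi (-(1 / 2) - j) - Real.log z with hA
  set p : ℝ := s + (j + 1 / 2) with hp
  have i1 := (integrableOn_rpow_mul_exp (p := p) (by linarith)).const_mul |A|
  have i2 := integrableOn_abs_log_moment (p := p) (by linarith)
  have hΓ0 := Real.Gamma_pos_of_pos (s := p) (by linarith)
  have hΓ1 := Real.Gamma_pos_of_pos (s := p + 1 / 2) (by linarith)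
  have hΓ2 := Real.Gamma_pos_of_pos (s := p - 1 / 2) (by linarith)
  have hbound : ∫ w in Ioi (0 : ℝ), ‖w ^ (s - 1) * Real.exp (-w) * oddTerm m (w * z) j‖ ≤
      ∫ w in Ioi (0 : ℝ), 2 / (j ! : ℝ) ^ 3 * z ^ (j + 1 / 2 : ℝ) *
        (|A| * (w ^ (p - 1) * Real.exp (-w)) + w ^ (p - 1) * Real.exp (-w) * |Real.log w|) := by
    refine setIntegral_mono_on (integrableOn_weighted_oddTerm hs hz m j).norm
      ((i1.add i2).const_mul _) measurableSet_Ioi fun w hw => ?_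
    have hw0 : (0 : ℝ) < w := hw
    rw [weighted_oddTerm m hz hw0, norm_mul, norm_mul, Real.norm_eq_abs, ← hA, ← hp,
      Real.norm_of_nonneg (show 0 ≤ z ^ (j + 1 / 2 : ℝ) by positivity)]
    have h1 := abs_odd_coefficient_le m j
    have h2 : ‖A * (w ^ (p - 1) * Real.exp (-w)) - w ^ (p - 1) * Real.exp (-w) * Real.log w‖ ≤
        |A| * (w ^ (p - 1) * Real.exp (-w)) + w ^ (p - 1) * Real.exp (-w) * |Real.log w| := by
      refine (norm_sub_le _ _).trans_eq ?_
      rw [norm_mul, norm_mul _ (Real.log w),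
        Real.norm_of_nonneg (show 0 ≤ w ^ (p - 1) * Real.exp (-w) by positivity),
        Real.norm_eq_abs, Real.norm_eq_abs]
    gcongr
  rw [integral_const_mul, integral_add i1 i2, integral_const_mul,
    integral_rpow_mul_exp (by linarith)] at hbound
  have h3 := integral_abs_log_moment_le (p := p) (by linarith)
  have h4 := abs_odd_constant_le m j (Real.log z)
  rw [← hA] at h4
  have h5 : z ^ (j + 1 / 2 : ℝ) = z ^ (1 / 2 : ℝ) * z ^ j := by
    rw [add_comm, Real.rpow_add hz, Real.rpow_natCast]
  have h6 : ∀ x : ℝ, 0 < x → x ≤ (j + 1) * x := fun x hx => by nlinarith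
  calc _ ≤ _ := hbound
    _ ≤ 2 / (j ! : ℝ) ^ 3 * z ^ (j + 1 / 2 : ℝ) * ((m + 7 + |Real.log z|) * (j + 1) *
          Real.Gamma p + (2 * ((j + 1) * Real.Gamma (p + 1 / 2)) +
            2 * ((j + 1) * Real.Gamma (p - 1 / 2)))) := by
      have h7 := h6 _ hΓ1
      have h8 := h6 _ hΓ2
      gcongr
      linarith
    _ = oddMajorant m s z j := by
      rw [oddMajorant, h5, hp, show s + 1 / 2 + (j : ℝ) = s + (j + 1 / 2) by ring,
        show s + 1 + (j : ℝ) = s + (j + 1 / 2) + 1 / 2 by ring,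
        show s + (j : ℝ) = s + (j + 1 / 2) - 1 / 2 by ring]
      ring

theorem weighted_polarTerm (m : ℕ) (s z w : ℝ) (r : ℕ) :
    w ^ (s - 1) * Real.exp (-w) * polarTerm m (w * z) r =
      (√Real.pi)⁻¹ * ((-1) ^ r / (r ! : ℝ) * (Real.Gamma (m - r) * Real.Gamma (m - r - 1 / 2))) *
        (w ^ (s - 1) * Real.exp (-w) * (w * z) ^ (r - m + 1 / 2 : ℝ)) := by
  rw [polarTerm]
  ring

theorem integrableOn_weighted_polarTerm {β z : ℝ} (hβ : 0 < β) (hz : 0 < z) (m r : ℕ) :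
    IntegrableOn (fun w : ℝ => w ^ (β - 1 / 2 + m - 1) * Real.exp (-w) * polarTerm m (w * z) r)
      (Ioi 0) := by
  simp only [weighted_polarTerm]
  have hr : (0 : ℝ) ≤ r := r.cast_nonneg
  exact (integrableOn_weighted_rpow hz (by linarith)).const_mul _

theorem integral_weighted_polarTerm {β z : ℝ} (hβ : 0 < β) (hz : 0 < z) {m r : ℕ} (hr : r < m) :
    ∫ w in Ioi (0 : ℝ), w ^ (β - 1 / 2 + m - 1) * Real.exp (-w) * polarTerm m (w * z) r =
      (√Real.pi)⁻¹ * (Real.Gamma (m - 1 / 2) * Real.Gamma m * Real.Gamma β *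
        z ^ (-m + 1 / 2 : ℝ) * ((-1) ^ r / (r ! : ℝ) *
          (poch β r / (poch (3 / 2 - m) r * poch (1 - m) r)) * z ^ r)) := by
  have hr0 : (0 : ℝ) ≤ r := r.cast_nonneg
  have hm : (r : ℝ) + 1 ≤ m := by exact_mod_cast hr
  have h1 := Gamma_sub_mul_poch (a := m) (r := r) (fun k hk => by
    have : (k : ℝ) + 1 ≤ r := by exact_mod_cast hk
    intro h
    linarith)
  have h2 := Gamma_sub_mul_poch (a := m - 1 / 2) (r := r) (fun k hk => by
    have : (k : ℝ) + 1 ≤ r := by exact_mod_cast hk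
    intro h
    linarith)
  rw [show 1 - ((m : ℝ) - 1 / 2) = 3 / 2 - m by ring,
    show (m : ℝ) - 1 / 2 - r = m - r - 1 / 2 by ring] at h2
  have g1 := (Real.Gamma_pos_of_pos (s := m) (by linarith)).ne'
  have g2 := (Real.Gamma_pos_of_pos (s := m - 1 / 2) (by linarith)).ne'
  -- A zero here would force Γ(m) = 0 in `h1`; the range r < m keeps the denominators of the finite
  -- sum nonzero.
  have p1 : poch (1 - m) r ≠ 0 := by
    intro h
    rw [h, mul_zero] at h1
    exact mul_ne_zero (pow_ne_zero r (by norm_num)) g1 h1.symm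
  have p2 : poch (3 / 2 - m) r ≠ 0 := by
    intro h
    rw [h, mul_zero] at h2
    exact mul_ne_zero (pow_ne_zero r (by norm_num)) g2 h2.symm
  have h3 : z ^ (r - m + 1 / 2 : ℝ) = z ^ (-m + 1 / 2 : ℝ) * z ^ r := by
    rw [← Real.rpow_natCast, ← Real.rpow_add hz]
    congr 1
    ring
  have h4 : ((-1 : ℝ) ^ r) * (-1) ^ r = 1 := by rw [← mul_pow]; simp
  simp only [weighted_polarTerm]
  rw [integral_const_mul, integral_weighted_rpow hz (by linarith),
    show β - 1 / 2 + (m : ℝ) + (r - m + 1 / 2) = β + r by ring, ← Gamma_mul_poch hβ, h3]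
  rw [← eq_div_iff p1] at h1
  rw [← eq_div_iff p2] at h2
  rw [h1, h2]
  generalize poch (1 - m) r = q1 at p1 ⊢
  generalize poch (3 / 2 - m) r = q2 at p2 ⊢
  generalize Real.Gamma (m - 1 / 2) = q3
  field_simp
  linear_combination (q3 * poch β r) * h4

/-! ### The double poles of the Mellin–Barnes integrand -/

/-- Invert the entire function 1/Γ where it does not vanish. -/
theorem analyticAt_Gamma {s : ℂ} (hs : ∀ n : ℕ, s ≠ -n) : AnalyticAt ℂ Complex.Gamma s := by
  have h : AnalyticAt ℂ (fun s => (Complex.Gamma s)⁻¹) s :=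
    Complex.differentiable_one_div_Gamma.analyticAt s
  exact (h.inv (inv_ne_zero (Complex.Gamma_ne_zero hs))).congr
    (Eventually.of_forall fun s => by simp)

theorem hasDerivAt_complex_Gamma_psi {s : ℝ} (hs : ∀ n : ℕ, s ≠ -n) :
    HasDerivAt Complex.Gamma (Complex.Gamma s * psi s) s := by
  have h := (Complex.differentiableAt_Gamma (s : ℂ) (complex_ne_neg_nat hs)).hasDerivAt
  have h0 := Complex.Gamma_ne_zero (complex_ne_neg_nat hs)
  rwa [← digamma_ofReal hs, Complex.digamma_def, logDeriv_apply, mul_div_cancel₀ _ h0]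

/-- The Laurent expansion of the Gamma function at a nonpositive integer. -/
theorem exists_Gamma_laurent (r : ℕ) :
    ∃ h : ℂ → ℂ, AnalyticAt ℂ h 0 ∧ h 0 = (((-1) ^ r / (r ! : ℝ) : ℝ) : ℂ) ∧
      HasDerivAt h (h 0 * psi (1 + r)) 0 ∧
      ∀ᶠ e in 𝓝[≠] (0 : ℂ), Complex.Gamma (-r + e) = h e / e := by
  induction r with
  | zero =>
    have hne := ne_neg_nat_of_pos one_pos
    have h1 := hasDerivAt_complex_Gamma_psi hne
    rw [Complex.ofReal_one] at h1
    refine ⟨fun e => Complex.Gamma (e + 1), ?_, by simp, ?_, ?_⟩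
    · have : AnalyticAt ℂ Complex.Gamma (0 + 1) := by
        rw [zero_add]
        exact_mod_cast analyticAt_Gamma (complex_ne_neg_nat hne)
      exact this.comp (f := fun e : ℂ => e + 1) (by fun_prop)
    · have : HasDerivAt Complex.Gamma (Complex.Gamma 1 * psi 1) (0 + 1) := by simpa using h1
      simpa using this.comp_add_const 0 1
    · filter_upwards [self_mem_nhdsWithin] with e he
      have he0 : e ≠ 0 := he
      rw [Complex.Gamma_add_one e he0, mul_div_cancel_left₀ _ he0]
      simp
  | succ r ih =>
    obtain ⟨h, ha, h0, hd, he⟩ := ih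
    have hr : (r : ℂ) + 1 ≠ 0 := by exact_mod_cast r.succ_ne_zero
    have hr' : (0 : ℂ) - (r + 1) ≠ 0 := by rwa [zero_sub, neg_ne_zero]
    -- From Γ(u) = Γ(u+1)/u with u = e - (r+1). The logarithmic derivative at e = 0 gains 1/(r+1),
    -- as ψ does.
    refine ⟨fun e => h e / (e - (r + 1)), ha.div (by fun_prop) hr', ?_, ?_, ?_⟩
    · show h 0 / (0 - (r + 1)) = _
      rw [h0, Nat.factorial_succ, pow_succ]
      push_cast
      have : (r ! : ℂ) ≠ 0 := by exact_mod_cast r.factorial_ne_zero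
      rw [zero_sub]
      field_simp
    · refine (hd.div ((hasDerivAt_id (0 : ℂ)).sub_const ((r : ℂ) + 1)) hr').congr_deriv ?_
      rw [psi_one_add_nat_succ]
      push_cast
      simp only [id, zero_sub]
      have hr2 : (1 : ℂ) + r ≠ 0 := by rwa [add_comm]
      field_simp
      ring
    · have hne : ∀ᶠ e : ℂ in 𝓝[≠] 0, e - (r + 1) ≠ 0 := by
        refine Filter.Eventually.filter_mono nhdsWithin_le_nhds ?_
        exact ContinuousAt.eventually_ne (by fun_prop) hr'
      filter_upwards [he, hne, self_mem_nhdsWithin] with e h1 h2 h3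
      have he0 : e ≠ 0 := h3
      have h4 := Complex.Gamma_add_one _ h2
      rw [show e - (r + 1) + 1 = -r + e by ring, h1] at h4
      rw [show -((r + 1 : ℕ) : ℂ) + e = e - (r + 1) by push_cast; ring]
      field_simp
      field_simp at h4
      linear_combination -h4

theorem analyticAt_dslope {f : ℂ → ℂ} {c : ℂ} (hf : AnalyticAt ℂ f c) :
    AnalyticAt ℂ (dslope f c) c := by
  obtain ⟨p, hp⟩ := hf
  exact ⟨p.fslope, hp.has_fpower_series_dslope_fslope⟩

/-- Taylor expansion of F to first order: the residue is F'(c), and the second divided slope is the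
analytic remainder. -/
theorem hasDoublePoleWithResidue_of_eventuallyEq {f F : ℂ → ℂ} {c d : ℂ} (hF : AnalyticAt ℂ F c)
    (hc : F c ≠ 0) (hd : HasDerivAt F d c) (hf : ∀ᶠ s in 𝓝[≠] c, f s = F s / (s - c) ^ 2) :
    HasDoublePoleWithResidue f c d := by
  refine ⟨F c, dslope (dslope F c) c, hc, analyticAt_dslope (analyticAt_dslope hF), ?_⟩
  filter_upwards [hf, self_mem_nhdsWithin] with s hs hsc
  have hne : s - c ≠ 0 := sub_ne_zero.mpr hsc
  have h1 := sub_smul_dslope F c s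
  have h2 := sub_smul_dslope (dslope F c) c s
  rw [dslope_same, hd.deriv, smul_eq_mul] at h2
  rw [smul_eq_mul] at h1
  rw [hs]
  field_simp
  linear_combination -h1 - (s - c) * h2

theorem hasDerivAt_mul_log {f g : ℂ → ℂ} {c p q : ℂ} (hf : HasDerivAt f (f c * p) c)
    (hg : HasDerivAt g (g c * q) c) :
    HasDerivAt (fun s => f s * g s) (f c * g c * (p + q)) c :=
  (hf.mul hg).congr_deriv (by ring)

theorem Gamma_neg_half_sub (r : ℕ) :
    Real.Gamma (-(1 / 2) - r) = -2 * √Real.pi * (-1) ^ r / poch (3 / 2) r := by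
  have h1 := Gamma_sub_mul_poch (a := -(1 / 2)) (r := r) (fun k _ => by
    have : (0 : ℝ) ≤ k := k.cast_nonneg
    intro h
    linarith)
  have h2 := Real.Gamma_add_one (s := -(1 / 2)) (by norm_num)
  rw [show -(1 / 2) + 1 = (1 / 2 : ℝ) by norm_num, Real.Gamma_one_half_eq] at h2
  rw [show (1 : ℝ) - -(1 / 2) = 3 / 2 by norm_num] at h1
  rw [eq_div_iff (poch_pos (by norm_num) r).ne', h1]
  linear_combination (2 * (-1) ^ r) * h2

theorem arg_pos {α b : ℝ} (hα : 1 < α) (hb : 0 < b) : 0 < arg α b := by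
  have : 0 < α - 1 := by linarith
  rw [arg]
  positivity

theorem barnesIntegrand_hasDoublePole {α b : ℝ} (hα : 1 < α) (hb : 0 < b) (m r : ℕ) :
    HasDoublePoleWithResidue (barnesIntegrand α b (-(m : ℝ) - 1 / 2)) (-(1 / 2) - r)
      (logTerm α b m r) := by
  -- With e = s - c the singular arguments are 1/2 + s = -r + e and 1 + ν + s = -(m+r) + e, so `h`
  -- and `k` are the numerators of the two simple poles.
  obtain ⟨h, ha, h0, hd, he⟩ := exists_Gamma_laurent r
  obtain ⟨k, ka, k0, kd, ke⟩ := exists_Gamma_laurent (m + r)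
  have hα0 : 0 < α - 1 := by linarith
  have hz := arg_pos hα hb
  set z := arg α b with hzd
  set β := 1 / (α - 1) with hβd
  have hβ : 0 < β := by positivity
  have hβpos : 0 < β + m + r := by positivity
  set c : ℂ := -(1 / 2) - r with hcd
  have hcr : c = ((-(1 / 2) - r : ℝ) : ℂ) := by push_cast; rfl
  have hz0 : (z : ℂ) ≠ 0 := by exact_mod_cast hz.ne'
  have hc1 := neg_half_sub_ne_neg_nat r
  have hc2 := ne_neg_nat_of_pos hβpos
  have hb2 : (β : ℂ) + m - 1 / 2 - c = ((β + m + r : ℝ) : ℂ) := by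
    rw [hcd]; push_cast; ring
  have d1 : HasDerivAt (fun s => h (s - c)) (h (c - c) * psi (1 + r)) c := by
    have : HasDerivAt h (h 0 * psi (1 + r)) (c - c) := by rwa [sub_self]
    simpa using this.comp_sub_const c c
  have d2 : HasDerivAt (fun s => k (s - c)) (k (c - c) * psi (1 + (m + r : ℕ))) c := by
    have : HasDerivAt k (k 0 * psi (1 + (m + r : ℕ))) (c - c) := by rwa [sub_self]
    simpa using this.comp_sub_const c c
  have d3 : HasDerivAt Complex.Gamma (Complex.Gamma c * psi (-(1 / 2) - r)) c := by
    rw [hcr]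
    exact hasDerivAt_complex_Gamma_psi hc1
  have d4 : HasDerivAt (fun s => Complex.Gamma (β + m - 1 / 2 - s))
      (Complex.Gamma (β + m - 1 / 2 - c) * (-psi (β + m + r) : ℝ)) c := by
    have h1 := hasDerivAt_complex_Gamma_psi hc2
    rw [← hb2] at h1
    refine (h1.comp_const_sub (β + m - 1 / 2 : ℂ) c).congr_deriv ?_
    push_cast
    ring
  have d5 : HasDerivAt (fun s : ℂ => (z : ℂ) ^ (-s)) ((z : ℂ) ^ (-c) * (-Real.log z : ℝ)) c := by
    refine ((hasDerivAt_neg c).const_cpow (c := (z : ℂ)) (Or.inl hz0)).congr_deriv ?_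
    rw [← Complex.ofReal_log hz.le]
    push_cast
    ring
  have a1 : AnalyticAt ℂ (fun s => h (s - c)) c := by
    have : AnalyticAt ℂ h (c - c) := by rwa [sub_self]
    exact this.comp (f := fun s : ℂ => s - c) (by fun_prop)
  have a2 : AnalyticAt ℂ (fun s => k (s - c)) c := by
    have : AnalyticAt ℂ k (c - c) := by rwa [sub_self]
    exact this.comp (f := fun s : ℂ => s - c) (by fun_prop)
  have a3 : AnalyticAt ℂ Complex.Gamma c := by
    rw [hcr]
    exact analyticAt_Gamma (complex_ne_neg_nat hc1)
  have a4 : AnalyticAt ℂ (fun s => Complex.Gamma (β + m - 1 / 2 - s)) c := by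
    have : AnalyticAt ℂ Complex.Gamma (β + m - 1 / 2 - c) := by
      rw [hb2]
      exact analyticAt_Gamma (complex_ne_neg_nat hc2)
    exact this.comp (f := fun s : ℂ => (β + m - 1 / 2 - s : ℂ)) (by fun_prop)
  have a5 : AnalyticAt ℂ (fun s : ℂ => (z : ℂ) ^ (-s)) c := by
    have : Differentiable ℂ (fun s : ℂ => (z : ℂ) ^ (-s)) := fun s =>
      (differentiableAt_id.neg.const_cpow (Or.inl hz0))
    exact this.analyticAt c
  have hd' := hasDerivAt_mul_log (hasDerivAt_mul_log (hasDerivAt_mul_log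
    (hasDerivAt_mul_log d1 d2) d3) d4) d5
  have hval : h (c - c) * k (c - c) * Complex.Gamma c * Complex.Gamma (β + m - 1 / 2 - c) *
      (z : ℂ) ^ (-c) = (((-1) ^ r / (r ! : ℝ) * ((-1) ^ (m + r) / ((m + r)! : ℝ)) *
        Real.Gamma (-(1 / 2) - r) * Real.Gamma (β + m + r) * z ^ (1 / 2 + r : ℝ) : ℝ) : ℂ) := by
    rw [sub_self, h0, k0, hb2, hcr, Complex.Gamma_ofReal, Complex.Gamma_ofReal,
      ← Complex.ofReal_neg, ← Complex.ofReal_cpow hz.le,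
      show -(-(1 / 2) - r : ℝ) = 1 / 2 + r by ring]
    push_cast
    rfl
  have hres : h (c - c) * k (c - c) * Complex.Gamma c * Complex.Gamma (β + m - 1 / 2 - c) *
      (z : ℂ) ^ (-c) * ((psi (1 + r) : ℂ) + psi (1 + (m + r : ℕ)) + psi (-(1 / 2) - r) +
        (-psi (β + m + r) : ℝ) + (-Real.log z : ℝ)) = logTerm α b m r := by
    rw [hval]
    simp only [← Complex.ofReal_add, ← Complex.ofReal_mul]
    congr 1
    have h4 : ((-1 : ℝ) ^ r) * (-1) ^ r = 1 := by rw [← mul_pow]; simp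
    have h5 := poch_pos (a := 3 / 2) (by norm_num) r
    have h6 : (1 + m + r : ℝ) = 1 + (m + r : ℕ) := by push_cast; ring
    rw [logTerm, coeffC, coeffD, ← hzd, ← hβd, Gamma_neg_half_sub, Real.rpow_add hz,
      Real.rpow_natCast, h6]
    generalize psi (-(1 / 2) - r) = p
    field_simp
    linear_combination (-(p + psi (1 + r) + psi (1 + (m + r : ℕ)) - psi (β + m + r) -
      Real.log z)) * h4
  rw [hres] at hd'
  refine hasDoublePoleWithResidue_of_eventuallyEq
    ((((a1.mul a2).mul a3).mul a4).mul a5) ?_ hd' ?_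
  · show h (c - c) * k (c - c) * Complex.Gamma c * Complex.Gamma (β + m - 1 / 2 - c) *
      (z : ℂ) ^ (-c) ≠ 0
    rw [hval]
    have g1 := Real.Gamma_ne_zero hc1
    have g2 := (Real.Gamma_pos_of_pos hβpos).ne'
    refine Complex.ofReal_ne_zero.mpr (mul_ne_zero (mul_ne_zero (mul_ne_zero ?_ g1) g2) ?_)
    · positivity
    · positivity
  · have ht : Tendsto (fun s : ℂ => s - c) (𝓝[≠] c) (𝓝[≠] 0) := by
      refine tendsto_nhdsWithin_iff.mpr ⟨?_, ?_⟩
      · have : Tendsto (fun s : ℂ => s - c) (𝓝 c) (𝓝 (c - c)) :=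
          (continuous_id.sub continuous_const).tendsto c
        rw [sub_self] at this
        exact this.mono_left nhdsWithin_le_nhds
      · filter_upwards [self_mem_nhdsWithin] with s hs
        exact sub_ne_zero.mpr hs
    filter_upwards [ht.eventually he, ht.eventually ke, self_mem_nhdsWithin] with s h1 h2 h3
    have hne : s - c ≠ 0 := sub_ne_zero.mpr h3
    have e1 : -(r : ℂ) + (s - c) = 1 / 2 + s := by rw [hcd]; ring
    have e2 : -((m + r : ℕ) : ℂ) + (s - c) = 1 + ((-(m : ℝ) - 1 / 2 : ℝ) : ℂ) + s := by
      rw [hcd]; push_cast; ring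
    have e3 : (1 : ℂ) / (α - 1) - ((-(m : ℝ) - 1 / 2 : ℝ) : ℂ) - 1 - s = β + m - 1 / 2 - s := by
      rw [hβd]; push_cast; ring
    rw [e1] at h1
    rw [e2] at h2
    simp only [barnesIntegrand]
    rw [h1, h2, e3, ← hzd]
    simp only [Pi.mul_apply]
    generalize Complex.Gamma (β + m - 1 / 2 - s) = g
    field_simp

/-! ### The expansion of the extended integral -/

/-- Padding the finite sum with zeros lets all three parts of the kernel share one index and one
termwise integration. -/
theorem hasSum_ite_lt (m : ℕ) (p : ℕ → ℝ) :
    HasSum (fun j => if j < m then p j else 0) (∑ r ∈ Finset.range m, p r) := by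
  rw [← Finset.sum_congr rfl fun j hj => if_pos (Finset.mem_range.mp hj)]
  exact hasSum_sum_of_ne_finset_zero fun j hj => if_neg (by simpa using hj)

theorem integral_add₃ {μ : Measure ℝ} {f g h : ℝ → ℝ} (hf : Integrable f μ)
    (hg : Integrable g μ) (hh : Integrable h μ) :
    ∫ x, f x + g x + h x ∂μ = ∫ x, f x ∂μ + ∫ x, g x ∂μ + ∫ x, h x ∂μ := by
  rw [← integral_add hf hg]
  exact integral_add (hf.add hg) hh

/-- The `r`-th term of the finite sum in the expansion of the extended integral. -/
noncomputable def finiteTerm (β z : ℝ) (m r : ℕ) : ℝ :=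
  (-1) ^ r / (r.factorial : ℝ) * (poch β r / (poch (3 / 2 - m) r * poch (1 - m) r)) * z ^ r

/-- The weighted terms of the expansion of the kernel. -/
noncomputable def weightedTerm (s z : ℝ) (m j : ℕ) (w : ℝ) : ℝ :=
  w ^ (s - 1) * Real.exp (-w) * evenTerm m (w * z) j +
    w ^ (s - 1) * Real.exp (-w) * oddTerm m (w * z) j +
    if j < m then w ^ (s - 1) * Real.exp (-w) * polarTerm m (w * z) j else 0

theorem integral_weighted_oddTerm_eq_logTerm {α b : ℝ} (hα : 1 < α) (hb : 0 < b) (m j : ℕ)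
    (hs : 0 < 1 / (α - 1) - 1 / 2 + m) :
    ∫ w in Ioi (0 : ℝ), w ^ (1 / (α - 1) - 1 / 2 + m - 1) * Real.exp (-w) *
      oddTerm m (w * arg α b) j = (√Real.pi)⁻¹ * logTerm α b m j := by
  have hz := arg_pos hα hb
  have hpi : 0 < √Real.pi := Real.sqrt_pos.mpr Real.pi_pos
  rw [integral_weighted_oddTerm hs hz, logTerm, coeffC, coeffD, Real.rpow_add hz,
    Real.rpow_natCast, show 1 / (α - 1) - 1 / 2 + (m : ℝ) + (j + 1 / 2) = 1 / (α - 1) + m + j by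
      ring]
  generalize psi (-(1 / 2) - j) = p
  generalize psi (1 / (α - 1) + m + j) = q
  generalize Real.Gamma (1 / (α - 1) + m + j) = g
  field_simp

theorem tsum_weightedTerm {s z w : ℝ} (hz : 0 < z) (hw : 0 < w) (m : ℕ) :
    ∑' j, weightedTerm s z m j w =
      w ^ (s - 1) * Real.exp (-w) * kernel (-m - 1 / 2) (2 * √(w * z)) := by
  obtain ⟨h1, h2, h3⟩ := kernel_eq m (mul_pos hw hz)
  have h := ((h1.hasSum.mul_left (w ^ (s - 1) * Real.exp (-w))).add
    (h2.hasSum.mul_left (w ^ (s - 1) * Real.exp (-w)))).add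
    (hasSum_ite_lt m fun j => w ^ (s - 1) * Real.exp (-w) * polarTerm m (w * z) j)
  simp only [weightedTerm]
  rw [h.tsum_eq, h3, ← Finset.mul_sum]
  ring

section

variable {α b : ℝ} (m j : ℕ)

theorem integrableOn_weightedTerm_polar (hα : 1 < α) (hb : 0 < b) :
    IntegrableOn (fun w : ℝ => if j < m then w ^ (1 / (α - 1) - 1 / 2 + m - 1) * Real.exp (-w) *
      polarTerm m (w * arg α b) j else 0) (Ioi 0) := by
  have hα0 : 0 < α - 1 := by linarith
  split_ifs
  · exact integrableOn_weighted_polarTerm (by positivity) (arg_pos hα hb) m j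
  · exact integrableOn_zero

theorem integrableOn_weightedTerm (hα : 1 < α) (hb : 0 < b) (hs : 0 < 1 / (α - 1) - 1 / 2 + m) :
    IntegrableOn (weightedTerm (1 / (α - 1) - 1 / 2 + m) (arg α b) m j) (Ioi 0) :=
  ((integrableOn_weighted_evenTerm hs (arg_pos hα hb) m j).add
    (integrableOn_weighted_oddTerm hs (arg_pos hα hb) m j)).add
    (integrableOn_weightedTerm_polar m j hα hb)

theorem integral_weightedTerm (hα : 1 < α) (hb : 0 < b) (hs : 0 < 1 / (α - 1) - 1 / 2 + m) :
    ∫ w in Ioi (0 : ℝ), weightedTerm (1 / (α - 1) - 1 / 2 + m) (arg α b) m j w =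
      Real.Gamma (1 / 2 - m) * Real.Gamma (1 / (α - 1) - 1 / 2 + m) *
          hyp1F2Term (1 / (α - 1) - 1 / 2 + m) (1 / 2) (1 / 2 + m) (-arg α b) j +
        (√Real.pi)⁻¹ * logTerm α b m j +
        if j < m then (√Real.pi)⁻¹ * (Real.Gamma (m - 1 / 2) * Real.Gamma m *
          Real.Gamma (1 / (α - 1)) * arg α b ^ (-m + 1 / 2 : ℝ) *
            finiteTerm (1 / (α - 1)) (arg α b) m j) else 0 := by
  have hα0 : 0 < α - 1 := by linarith
  have hz := arg_pos hα hb
  have i1 := integrableOn_weighted_evenTerm hs hz m j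
  have i2 := integrableOn_weighted_oddTerm hs hz m j
  simp only [weightedTerm]
  rw [integral_add₃ i1 i2 (integrableOn_weightedTerm_polar m j hα hb),
    integral_weighted_evenTerm hs hz, integral_weighted_oddTerm_eq_logTerm hα hb m j hs]
  congr 1
  split_ifs with h
  · rw [integral_weighted_polarTerm (by positivity) hz h, finiteTerm]
  · simp

/-- Summable L¹ norms license the exchange of sum and integral: exact norms for the even part,
`oddMajorant` for the logarithmic part, finitely many nonzero terms for the polar part. -/
theorem summable_integral_norm_weightedTerm (hα : 1 < α) (hb : 0 < b)
    (hs : 0 < 1 / (α - 1) - 1 / 2 + m) :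
    Summable fun j => ∫ w in Ioi (0 : ℝ),
      ‖weightedTerm (1 / (α - 1) - 1 / 2 + m) (arg α b) m j w‖ := by
  have hz := arg_pos hα hb
  have hE := ((summable_hyp1F2Term hs (c := 1 / 2) (d := 1 / 2 + m) (by norm_num) (by positivity)
    (neg_ne_zero.mpr hz.ne')).mul_left
      (Real.Gamma (1 / 2 - m) * Real.Gamma (1 / (α - 1) - 1 / 2 + m))).norm
  have hO := summable_oddMajorant m hs hz
  have hP := (hasSum_ite_lt m fun j => ∫ w in Ioi (0 : ℝ),
    ‖w ^ (1 / (α - 1) - 1 / 2 + m - 1) * Real.exp (-w) * polarTerm m (w * arg α b) j‖).summable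
  refine Summable.of_nonneg_of_le (fun j => integral_nonneg fun _ => norm_nonneg _) (fun j => ?_)
    ((hE.add hO).add hP)
  have i1 := (integrableOn_weighted_evenTerm hs hz m j).norm
  have i2 := (integrableOn_weighted_oddTerm hs hz m j).norm
  have i3 := (integrableOn_weightedTerm_polar m j hα hb).norm
  refine (integral_mono (integrableOn_weightedTerm m j hα hb hs).norm ((i1.add i2).add i3)
    fun w => norm_add₃_le).trans ?_
  simp only [Pi.add_apply]
  rw [integral_add₃ i1 i2 i3, integral_norm_weighted_evenTerm hs hz]
  refine add_le_add (add_le_add le_rfl (integral_norm_weighted_oddTerm_le hs hz m j)) ?_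
  split_ifs <;> simp

theorem summable_logTerm (hα : 1 < α) (hb : 0 < b) (hs : 0 < 1 / (α - 1) - 1 / 2 + m) :
    Summable (logTerm α b m) := by
  have hpi : 0 < √Real.pi := Real.sqrt_pos.mpr Real.pi_pos
  have h : Summable fun j => (√Real.pi)⁻¹ * logTerm α b m j := by
    refine Summable.of_norm_bounded (summable_oddMajorant m hs (arg_pos hα hb)) fun j => ?_
    rw [← integral_weighted_oddTerm_eq_logTerm hα hb m j hs]
    exact (norm_integral_le_integral_norm _).trans
      (integral_norm_weighted_oddTerm_le hs (arg_pos hα hb) m j)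
  exact (summable_mul_left_iff (inv_ne_zero hpi.ne')).mp h

theorem integral_weighted_kernel (hα : 1 < α) (hb : 0 < b)
    (hs : 0 < 1 / (α - 1) - 1 / 2 + m) :
    ∫ w in Ioi (0 : ℝ), w ^ (1 / (α - 1) - 1 / 2 + m - 1) * Real.exp (-w) *
        kernel (-m - 1 / 2) (2 * √(w * arg α b)) =
      Real.Gamma (1 / 2 - m) * Real.Gamma (1 / (α - 1) - 1 / 2 + m) *
          hyp1F2 (1 / (α - 1) - 1 / 2 + m) (1 / 2) (1 / 2 + m) (-arg α b) +
        (√Real.pi)⁻¹ * ∑' j, logTerm α b m j +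
        (√Real.pi)⁻¹ * (Real.Gamma (m - 1 / 2) * Real.Gamma m * Real.Gamma (1 / (α - 1)) *
          arg α b ^ (-m + 1 / 2 : ℝ) *
            ∑ r ∈ Finset.range m, finiteTerm (1 / (α - 1)) (arg α b) m r) := by
  have hz := arg_pos hα hb
  have h := hasSum_integral_of_summable_integral_norm
    (fun j => integrableOn_weightedTerm m j hα hb hs)
    (summable_integral_norm_weightedTerm m hα hb hs)
  rw [setIntegral_congr_fun measurableSet_Ioi fun w hw => tsum_weightedTerm hz hw m] at h
  refine h.unique ?_
  have hE := summable_hyp1F2Term hs (c := 1 / 2) (d := 1 / 2 + m) (by norm_num) (by positivity)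
    (neg_ne_zero.mpr hz.ne')
  have h2 := ((hE.hasSum.mul_left
      (Real.Gamma (1 / 2 - m) * Real.Gamma (1 / (α - 1) - 1 / 2 + m))).add
    ((summable_logTerm m hα hb hs).hasSum.mul_left (√Real.pi)⁻¹)).add
    (hasSum_ite_lt m fun j => (√Real.pi)⁻¹ * (Real.Gamma (m - 1 / 2) * Real.Gamma m *
      Real.Gamma (1 / (α - 1)) * arg α b ^ (-m + 1 / 2 : ℝ) *
        finiteTerm (1 / (α - 1)) (arg α b) m j))
  rw [← Finset.mul_sum, ← Finset.mul_sum] at h2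
  exact h2.congr_fun fun j => integral_weightedTerm m j hα hb hs

end

end Pathway

/-! ### The expansion of the extended integral and its double poles -/

theorem mainTheorem5 (m : ℕ) (α b : ℝ) (hb : 0 < b) (hα : 1 < α)
    (hconv : 1 / 2 - (m : ℝ) < 1 / (α - 1)) :
    MeasureTheory.IntegrableOn (Pathway.integrand α b (-(m : ℝ) - 1 / 2)) (Set.Ioi 0) ∧
    Summable (Pathway.hyp1F2Term (1 / (α - 1) - 1 / 2 + m) (1 / 2) (1 / 2 + m)
      (-Pathway.arg α b)) ∧
    Summable (Pathway.logTerm α b m) ∧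
    (Pathway.extIntegral α b (-(m : ℝ) - 1 / 2) =
      (√Real.pi)⁻¹ / ((α - 1) ^ (1 / 2 - m : ℝ) * Real.Gamma (1 / (α - 1))) *
        (√Real.pi * Real.Gamma (1 / 2 - m) * Real.Gamma (1 / (α - 1) - 1 / 2 + m) *
            Pathway.hyp1F2 (1 / (α - 1) - 1 / 2 + m) (1 / 2) (1 / 2 + m) (-Pathway.arg α b) +
          Real.Gamma (m - 1 / 2) * Real.Gamma m * Real.Gamma (1 / (α - 1)) *
            Pathway.arg α b ^ (-m + 1 / 2 : ℝ) *
            ∑ r ∈ Finset.range m, (-1) ^ r / (r.factorial : ℝ) *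
              (Pathway.poch (1 / (α - 1)) r /
                (Pathway.poch (3 / 2 - m) r * Pathway.poch (1 - m) r)) *
              Pathway.arg α b ^ r +
          ∑' r : ℕ, Pathway.logTerm α b m r)) ∧
    ∀ r : ℕ, Pathway.HasDoublePoleWithResidue
      (Pathway.barnesIntegrand α b (-(m : ℝ) - 1 / 2)) (-(1 / 2) - r)
      (Pathway.logTerm α b m r) := by
  have hα0 : 0 < α - 1 := by linarith
  have hs : 0 < 1 / (α - 1) - 1 / 2 + m := by linarith
  have hν : -(m : ℝ) - 1 / 2 + 1 < 1 / (α - 1) := by linarith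
  refine ⟨Pathway.integrableOn_integrand hα hb hν,
    Pathway.summable_hyp1F2Term hs (by norm_num) (by positivity)
      (neg_ne_zero.mpr (Pathway.arg_pos hα hb).ne'),
    Pathway.summable_logTerm m hα hb hs, ?_, Pathway.barnesIntegrand_hasDoublePole hα hb m⟩
  have h1 := Pathway.Gamma_mul_extIntegral hα hb hν
  have h2 := Pathway.integral_weighted_kernel m hα hb hs
  have hΓ := Real.Gamma_pos_of_pos (s := 1 / (α - 1)) (by positivity)
  have hpi : 0 < √Real.pi := Real.sqrt_pos.mpr Real.pi_pos
  rw [show 1 / (α - 1) - (-(m : ℝ) - 1 / 2) - 1 - 1 = 1 / (α - 1) - 1 / 2 + m - 1 by ring, h2,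
    show -(-(m : ℝ) - 1 / 2) - 1 = -(1 / 2 - m) by ring, Real.rpow_neg hα0.le] at h1
  simp only [Pathway.finiteTerm] at h1
  rw [← mul_right_inj' hΓ.ne', h1]
  have hp : (α - 1) ^ (1 / 2 - m : ℝ) ≠ 0 := (Real.rpow_pos_of_pos hα0 _).ne'
  -- Here g = Γ(β), p = (α-1)^(1/2-m), P = √π, and x, L, S are the hypergeometric, logarithmic and
  -- finite parts. For m = 0 the finite part is an empty sum.
  have alg : ∀ g p P x L S : ℝ, g ≠ 0 → p ≠ 0 → P ≠ 0 →
      p⁻¹ * (x + P⁻¹ * L + P⁻¹ * S) = g * (P⁻¹ / (p * g) * (P * x + S + L)) := by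
    intro g p P x L S hg hp hP
    field_simp
    ring
  refine (alg _ _ _ _ _ _ hΓ.ne' hp hpi.ne').trans ?_
  ring
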